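/- **Notation.** Let $t\ge 2$ and let $\tau_n=(n_1,\dots,n_t)$ be a partition of $n$ into positive integers. Partition $M\in\mathbb R^{n\times n}$ conformally as $M=[M_{jk}]$ with $M_{jk}\in\mathbb R^{n_j\times n_k}$; put $\mathrm{Bdiag}(M)=\mathrm{diag}(M_{11},\dots,M_{tt})$, and let $\mathbb D_{\tau_n}$ be the set of $M$ with $M=\mathrm{Bdiag}(M)$. Let $\mathbb P_{\tau_n}$ be the set of permutation matrices $\Pi$ with $\Pi^{T}D\Pi\in\mathbb D_{\tau_n}$ for all $D\in\mathbb D_{\tau_n}$, and let $\mathbb W_{\tau_n}$ be the set of nonsingular $W\in\mathbb R^{n\times n}$ with $\mathrm{Bdiag}(W^{T}W)=I_n$. Write $\|\cdot\|_2,\|\cdot\|_F$ for the spectral and Frobenius norms and $\kappa_2(Q)=\|Q\|_2\|Q^{-1}\|_2$. A matrix with $N$ columns has $N$ singular values, and $\sigma_{\min}$ is the smallest of them. **Setting.** Let $\mathcal A=\{A_i\}_{i=1}^m\subset\mathbb R^{n\times n}$ and let $W\in\mathbb W_{\tau_n}$ satisfy $W^{T}A_iW=\mathrm{diag}(A_i^{(11)},\dots,A_i^{(tt)})\in\mathbb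 D_{\tau_n}$ for all $i$. Put $\mathcal A_j=\{A_i^{(jj)}\}_{i=1}^m$ and $$\mathscr N(\mathcal A_j)=\{Z\in\mathbb R^{n_j\times n_j}: A_i^{(jj)}Z-Z^{T}A_i^{(jj)}=0\ \text{for all } i\},$$ and assume $\dim\mathscr N(\mathcal A_j)=1$ for every $j$. For $j<k$ let $G_{jk}$ be the matrix obtained by stacking, for $i=1,\dots,m$, the block rows $$[\,I_{n_k}\otimes A_i^{(jj)},\ (A_i^{(kk)})^{T}\otimes I_{n_j}\,],\qquad [\,I_{n_k}\otimes (A_i^{(jj)})^{T},\ A_i^{(kk)}\otimes I_{n_j}\,],$$ and let $G_{jj}$ be obtained by stacking $I_{n_j}\otimes A_i^{(jj)}-[(A_i^{(jj)})^{T}\otimes I_{n_j}]\Pi_j$, $i=1,\dots,m$, where $\Pi_j$ is the permutation matrix with $\Pi_j\,\mathrm{vec}(Z^{T})=\mathrm{vec}(Z)$ for all $Z\in\mathbb R^{n_j\times n_j}$. Put $$\omega_{\rm uniq}=\min_{1\le j<k\le t}\sigma_{\min}(G_{jk}),\qquad \omega_{\rm robu}=\min_{n_j>1}\{\text{smallest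 nonzero singular value of }G_{jj}\},$$ with $\omega_{\rm robu}=\infty$ if all $n_j=1$. Let $\widetilde{\mathcal A}=\{\widetilde A_i\}_{i=1}^m=\{A_i+\Delta A_i\}_{i=1}^m$ be a perturbed set of real matrices and let $\widetilde W\in\mathbb W_{\tau_n}$ (an approximate block diagonalizer of $\widetilde{\mathcal A}$, its quality being measured by $\tilde r$ below). Let $\gamma_1,\dots,\gamma_t$ be distinct real numbers with $|\gamma_j|\le1$, $\Gamma=\mathrm{diag}(\gamma_1I_{n_1},\dots,\gamma_tI_{n_t})$, $g=\min_{j\ne k}|\gamma_j-\gamma_k|$, and $$\widetilde R_i=\widetilde W^{T}\widetilde A_i\widetilde W\,\Gamma-\Gamma\,\widetilde W^{T}\widetilde A_i\widetilde W,\qquad \tilde r=\Big(\sum_{i=1}^m\|\widetilde R_i\|_F^2\Big)^{1/2},\qquad \delta_{\mathcal A}=\Big(\sum_{i=1}^m\|\Delta A_i\|_F^2\Big)^{1/2}.$$ Finally let $Q=W^{-1}\widetilde W$ and $$\tau=\frac{\sqrt2-1}{\sqrt{t-1}},\quad \alpha=\frac{2\tau}{(\sqrt2+\tau)^2},\quad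 \delta=\|Q^{-1}\|_2^2\,\tilde r+2\|Q^{-1}\|_2\|W\|_2\|\widetilde W\|_2\,\delta_{\mathcal A},\quad \epsilon_*=\frac{\tau\,\kappa_2(Q)\,\delta}{\alpha\, g\,\omega_{\rm uniq}}.$$ **Theorem.** If $$\delta<\min\Big\{\frac{\alpha g\,\omega_{\rm uniq}}{\kappa_2(Q)},\ \frac{(1-2\alpha)g\,\omega_{\rm robu}}{\sqrt2}\Big\},$$ then for $p\in\{2,F\}$ the following minimum is attained and satisfies $$\min_{\substack{D\in\mathbb D_{\tau_n},\,D^{T}D=I\\ \Pi\in\mathbb P_{\tau_n}}}\frac{\|W-\widetilde WD\Pi\|_p}{\|\widetilde W\|_p}\ \le\ \frac{1+\sqrt t\,\epsilon_*}{\sqrt{1-2\sqrt{t-1}\,\epsilon_*-(t-1)\epsilon_*^2}}-1 .$$ As a function of $\delta\ge 0$ (with $\kappa_2(Q)$, $g$ and $\omega_{\rm uniq}$ fixed), the right-hand side equals $$\frac{\tau}{\alpha}\cdot\frac{(\sqrt t+\sqrt{t-1})\,\kappa_2(Q)\,\delta}{g\,\omega_{\rm uniq}}+O(\delta^2)\qquad(\delta\to0);$$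 more precisely, there are constants $C,\eta>0$ depending only on $t$ such that the two differ by at most $C\big(\kappa_2(Q)\delta/(g\,\omega_{\rm uniq})\big)^2$ whenever $\kappa_2(Q)\delta/(g\,\omega_{\rm uniq})\le\eta$. -/

import Mathlib

open scoped Matrix Kronecker

noncomputable section

namespace JBD

/-! ### Partitions and block structure -/

/-- The index set `{1, …, n}` partitioned into `t` consecutive blocks of sizes `s 0, …, s (t-1)`:
the pair `⟨j, a⟩` is the `a`-th index of the `j`-th block. -/
abbrev Idx {t : ℕ} (s : Fin t → ℕ) : Type := (j : Fin t) × Fin (s j)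

/-- Real `n × n` matrices, rows and columns partitioned according to `s`. -/
abbrev Mat {t : ℕ} (s : Fin t → ℕ) : Type := Matrix (Idx s) (Idx s) ℝ

/-- The block diagonal part `diag(M₁₁, …, M_tt)`. -/
def bdiag {t : ℕ} {s : Fin t → ℕ} (M : Mat s) : Mat s :=
  Matrix.blockDiagonal' (Matrix.blockDiag' M)

/-- The off-block diagonal part. -/
def offBdiag {t : ℕ} {s : Fin t → ℕ} (M : Mat s) : Mat s := M - bdiag M

/-- The set `𝔻` of block diagonal matrices. -/
def blockDiagSet {t : ℕ} (s : Fin t → ℕ) : Set (Mat s) := {M | offBdiag M = 0}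

/-- The set `ℙ` of block diagonal preserving permutation matrices. -/
def blockPermSet {t : ℕ} (s : Fin t → ℕ) : Set (Mat s) :=
  {P | (∃ σ : Equiv.Perm (Idx s), P = σ.permMatrix ℝ) ∧
    ∀ D ∈ blockDiagSet s, Pᵀ * D * P ∈ blockDiagSet s}

/-- The set `𝕎` of nonsingular matrices `W` with `Bdiag(Wᵀ W) = I`. -/
def normalizedSet {t : ℕ} (s : Fin t → ℕ) : Set (Mat s) :=
  {W | IsUnit W ∧ bdiag (Wᵀ * W) = 1}

/-- `W` is a block diagonalizer of the matrix set `A = {A_i}`. -/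
def IsBlockDiagonalizer {t : ℕ} {s : Fin t → ℕ} {m : ℕ} (A : Fin m → Mat s) (W : Mat s) : Prop :=
  IsUnit W ∧ ∀ i, Wᵀ * A i * W ∈ blockDiagSet s

/-- The set `𝒜_j` of the `j`-th diagonal blocks `A_i^{(jj)}` of the matrices `Wᵀ A_i W`. -/
def diagBlocks {t : ℕ} {s : Fin t → ℕ} {m : ℕ} (A : Fin m → Mat s) (W : Mat s) (j : Fin t) :
    Fin m → Matrix (Fin (s j)) (Fin (s j)) ℝ :=
  fun i => Matrix.blockDiag' (Wᵀ * A i * W) j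

/-- The subspace `𝒩(𝒜) = {Z : A_i Z - Zᵀ A_i = 0 for all i}`. -/
def nullSpace {ι : Type*} [Fintype ι] {m : ℕ} (A : Fin m → Matrix ι ι ℝ) :
    Submodule ℝ (Matrix ι ι ℝ) where
  carrier := {Z | ∀ i, A i * Z - Zᵀ * A i = 0}
  zero_mem' := by simp
  add_mem' := by
    intro X Y hX hY i
    rw [Matrix.mul_add, Matrix.transpose_add, Matrix.add_mul, add_sub_add_comm, hX i, hY i,
      add_zero]
  smul_mem' := by
    intro c X hX i
    rw [Matrix.mul_smul, Matrix.transpose_smul, Matrix.smul_mul, ← smul_sub, hX i, smul_zero]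

/-! ### Norms and singular values -/

open scoped Matrix.Norms.L2Operator in
/-- The spectral norm. -/
def specNorm {ι : Type*} [Fintype ι] [DecidableEq ι] (M : Matrix ι ι ℝ) : ℝ := ‖M‖

open scoped Matrix.Norms.Frobenius in
/-- The Frobenius norm. -/
def frobNorm {ι : Type*} [Fintype ι] [DecidableEq ι] (M : Matrix ι ι ℝ) : ℝ := ‖M‖

/-- The Frobenius norm `(∑ᵢ ‖A_i‖_F²)^{1/2}` of a finite family of matrices. -/
def famNorm {ι : Type*} [Fintype ι] [DecidableEq ι] {m : ℕ} (A : Fin m → Matrix ι ι ℝ) : ℝ :=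
  √(∑ i, frobNorm (A i) ^ 2)

/-- The spectral condition number `κ₂(Q) = ‖Q‖₂ ‖Q⁻¹‖₂`. -/
def cond2 {ι : Type*} [Fintype ι] [DecidableEq ι] (Q : Matrix ι ι ℝ) : ℝ :=
  specNorm Q * specNorm Q⁻¹

/-- Singular values in decreasing order; those with index below the number of columns are the
singular values of `G` (as many as `G` has columns), the later entries are `0`. -/
def singVal {r c : Type*} [Fintype r] [Fintype c] [DecidableEq c]
    (G : Matrix r c ℝ) (k : ℕ) : ℝ :=
  (Matrix.toEuclideanLin G).singularValues k

/-- The smallest singular value; a matrix with `n` columns has `n` singular values. -/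
def sigmaMin {r c : Type*} [Fintype r] [Fintype c] [DecidableEq c] (G : Matrix r c ℝ) : ℝ :=
  ⨅ k : Fin (Fintype.card c), singVal G k

/-! ### The moduli of uniqueness and of non-divisibility -/

/-- The matrix `G_{jk}` (for `j ≠ k`) built from the families `A = 𝒜_j` and `B = 𝒜_k`: for each
`i` it has the two block rows `[I ⊗ A_i, B_iᵀ ⊗ I]` and `[I ⊗ A_iᵀ, B_i ⊗ I]`. -/
def offG {ι κ : Type*} [DecidableEq ι] [DecidableEq κ] {m : ℕ}
    (A : Fin m → Matrix ι ι ℝ) (B : Fin m → Matrix κ κ ℝ) :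
    Matrix (Fin m × ((κ × ι) ⊕ (κ × ι))) ((κ × ι) ⊕ (κ × ι)) ℝ :=
  Matrix.of fun r =>
    Matrix.fromBlocks
      ((1 : Matrix κ κ ℝ) ⊗ₖ A r.1) ((B r.1)ᵀ ⊗ₖ (1 : Matrix ι ι ℝ))
      ((1 : Matrix κ κ ℝ) ⊗ₖ (A r.1)ᵀ) (B r.1 ⊗ₖ (1 : Matrix ι ι ℝ)) r.2

/-- The perfect shuffle permutation matrix, which maps `vec (Zᵀ)` to `vec Z`. -/
def shuffle (ι : Type*) [DecidableEq ι] : Matrix (ι × ι) (ι × ι) ℝ :=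
  Matrix.of fun p q => if q = p.swap then 1 else 0

/-- The matrix `G_{jj}` built from the family `A = 𝒜_j`: its block rows are
`I ⊗ A_i - (A_iᵀ ⊗ I) Π`, with `Π` the perfect shuffle. -/
def diagG {ι : Type*} [Fintype ι] [DecidableEq ι] {m : ℕ} (A : Fin m → Matrix ι ι ℝ) :
    Matrix (Fin m × (ι × ι)) (ι × ι) ℝ :=
  Matrix.of fun r =>
    ((1 : Matrix ι ι ℝ) ⊗ₖ A r.1 - ((A r.1)ᵀ ⊗ₖ (1 : Matrix ι ι ℝ)) * shuffle ι) r.2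

/-- The modulus of uniqueness `min_{j<k} σ_min(G_{jk})`. -/
def omegaUniq {t : ℕ} {s : Fin t → ℕ} {m : ℕ} (A : Fin m → Mat s) (W : Mat s) : ℝ :=
  ⨅ p : {p : Fin t × Fin t // p.1 < p.2},
    sigmaMin (offG (diagBlocks A W p.1.1) (diagBlocks A W p.1.2))

/-- The modulus of non-divisibility: the minimum, over the `j` with `n_j > 1`, of the smallest
nonzero singular value of `G_{jj}`; it is `∞` if all `n_j` are `1`. -/
def omegaRobu {t : ℕ} {s : Fin t → ℕ} {m : ℕ} (A : Fin m → Mat s) (W : Mat s) : EReal :=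
  ⨅ (j : Fin t) (_ : 1 < s j) (k : ℕ) (_ : singVal (diagG (diagBlocks A W j)) k ≠ 0),
    ((singVal (diagG (diagBlocks A W j)) k : ℝ) : EReal)

/-! ### Residuals and the quantities in the bound -/

/-- `Γ = diag(γ₁ I, …, γ_t I)`. -/
def gammaMat {t : ℕ} (s : Fin t → ℕ) (γ : Fin t → ℝ) : Mat s :=
  Matrix.diagonal fun x => γ x.1

/-- `g = min_{j ≠ k} |γ_j - γ_k|`. -/
def gap {t : ℕ} (γ : Fin t → ℝ) : ℝ :=
  ⨅ p : {p : Fin t × Fin t // p.1 ≠ p.2}, |γ p.1.1 - γ p.1.2|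

/-- The residuals `R̃_i = W̃ᵀ Ã_i W̃ Γ - Γ W̃ᵀ Ã_i W̃`. -/
def residual {t : ℕ} {s : Fin t → ℕ} {m : ℕ} (A' : Fin m → Mat s) (W' : Mat s) (γ : Fin t → ℝ) :
    Fin m → Mat s :=
  fun i => W'ᵀ * A' i * W' * gammaMat s γ - gammaMat s γ * (W'ᵀ * A' i * W')

/-- `δ = ‖Q⁻¹‖₂² r̃ + 2 ‖Q⁻¹‖₂ ‖W‖₂ ‖W̃‖₂ δ_𝒜` with `Q = W⁻¹ W̃`, where `r̃` is the size of the
residuals and `δ_𝒜` that of the perturbations `Ã_i - A_i`. -/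
def delta {t : ℕ} {s : Fin t → ℕ} {m : ℕ} (A A' : Fin m → Mat s) (W W' : Mat s)
    (γ : Fin t → ℝ) : ℝ :=
  specNorm (W⁻¹ * W')⁻¹ ^ 2 * famNorm (residual A' W' γ)
    + 2 * specNorm (W⁻¹ * W')⁻¹ * specNorm W * specNorm W' * famNorm (fun i => A' i - A i)

/-- `τ = (√2 - 1) / √(t - 1)`. -/
def tau (t : ℕ) : ℝ := (√2 - 1) / √((t : ℝ) - 1)

/-- `α = 2 τ / (√2 + τ)²`. -/
def alpha (t : ℕ) : ℝ := 2 * tau t / (√2 + tau t) ^ 2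

/-- `ε(d) = τ κ d / (α g ω)`; at `d = δ` this is `ε_*`. -/
def epsStar (t : ℕ) (κ g ω d : ℝ) : ℝ := tau t * κ * d / (alpha t * g * ω)

/-- The bound `(1 + √t ε) / √(1 - 2 √(t-1) ε - (t-1) ε²) - 1`. -/
def errBound (t : ℕ) (ε : ℝ) : ℝ :=
  (1 + √(t : ℝ) * ε) / √(1 - 2 * √((t : ℝ) - 1) * ε - ((t : ℝ) - 1) * ε ^ 2) - 1

/-- The relative distances `‖W - W̃ D Π‖ / ‖W̃‖` in the norm `N`, over all orthogonal block
diagonal `D` and all block diagonal preserving permutation matrices `Π`. -/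
def relDistSet {t : ℕ} {s : Fin t → ℕ} (N : Mat s → ℝ) (W W' : Mat s) : Set ℝ :=
  {x | ∃ D ∈ blockDiagSet s, Dᵀ * D = 1 ∧ ∃ P ∈ blockPermSet s, x = N (W - W' * D * P) / N W'}

end JBD

end

noncomputable section

namespace JBD

/-! ### Frobenius and spectral norms -/

section Frobenius

open scoped Matrix.Norms.Frobenius

/-! Put `Q = W⁻¹ * W'` and `Z = Q Γ Q⁻¹`. If `W'` block diagonalized the original family exactly,
`Z` would solve `D_i Z = Zᵀ D_i` for the block diagonal matrices `D_i = Wᵀ A_i W`; in general the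
defect of these equations has size at most `δ` (`famNorm_residual_le_delta`). The system decouples
over pairs of blocks, with coefficient matrices `G_jk` and `G_jj`. Hence the off-diagonal part of
`Z` has Frobenius norm at most `δ / ω_uniq` (`omegaUniq_mul_frobNorm_offBdiag_le`). Since the kernel
of `G_jj` consists of scalar matrices only, each block `Z_jj` with `n_j > 1` lies within `δ /
ω_robu` of a scalar matrix (`exists_scalar_mul_norm_blk_sub_le`); blocks of size one are scalar
anyway.

Discarding the off-diagonal part of `Z` gives `Bdiag(Z) Q = Q (Γ + E)` with `‖E‖_F ≤ κ δ / ω_uniq <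
α g`. A contraction argument for a Riccati equation (`exists_block_diagonalization`) produces `P`
with zero diagonal blocks and `‖P‖_F ≤ ε_*` such that `X = Q (1 + P)` intertwines `Bdiag(Z)` with a
block diagonal matrix whose `k`-th block has spectrum within `‖E‖_F` of `γ_k`. Two nonzero blocks in
the same block row of `X` would give a single `Z_jj` two eigenvalues too far apart for a nearly
scalar matrix (`eq_of_blk_ne_zero`). As `X` is invertible, it is a block permutation pattern
(`exists_perm_of_blk_subsingleton`).

Now `W X = W' (1 + P)`. After a permutation `X` becomes a block diagonal `D`, and the normalizations
of `W` and `W'` force `D` to be nearly orthogonal. Replacing `D` by its orthogonal polar factor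
gives the distance bound (`exists_mem_relDistSet_le`), which is at most the stated one. The minimum
is attained because the admissible pairs form finitely many copies of a compact set. -/

theorem frobenius_norm_sq {m n 𝕜 : Type*} [Fintype m] [Fintype n] [RCLike 𝕜] (A : Matrix m n 𝕜) :
    ‖A‖ ^ 2 = ∑ i, ∑ j, ‖A i j‖ ^ 2 := by
  rw [Matrix.frobenius_norm_def, ← Real.sqrt_eq_rpow, Real.sq_sqrt (by positivity)]
  simp

end Frobenius

section Norms

variable {ι : Type*} [Fintype ι] [DecidableEq ι]

theorem frobNorm_sq (M : Matrix ι ι ℝ) : frobNorm M ^ 2 = ∑ i, ∑ j, M i j ^ 2 := by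
  exact (frobenius_norm_sq M).trans (by simp)

open scoped Matrix.Norms.Frobenius in
theorem frobNorm_nonneg (M : Matrix ι ι ℝ) : 0 ≤ frobNorm M := norm_nonneg M

theorem frobNorm_eq_sqrt (M : Matrix ι ι ℝ) : frobNorm M = √(∑ i, ∑ j, M i j ^ 2) := by
  rw [← frobNorm_sq, Real.sqrt_sq (frobNorm_nonneg M)]

open scoped Matrix.Norms.Frobenius in
theorem frobNorm_add_le (M N : Matrix ι ι ℝ) : frobNorm (M + N) ≤ frobNorm M + frobNorm N :=
  norm_add_le M N

open scoped Matrix.Norms.Frobenius in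
theorem frobNorm_sub_le (M N : Matrix ι ι ℝ) : frobNorm (M - N) ≤ frobNorm M + frobNorm N :=
  norm_sub_le M N

open scoped Matrix.Norms.Frobenius in
theorem frobNorm_neg (M : Matrix ι ι ℝ) : frobNorm (-M) = frobNorm M :=
  norm_neg M

open scoped Matrix.Norms.Frobenius in
theorem frobNorm_mul_le (M N : Matrix ι ι ℝ) : frobNorm (M * N) ≤ frobNorm M * frobNorm N :=
  Matrix.frobenius_norm_mul M N

open scoped Matrix.Norms.Frobenius in
theorem frobNorm_transpose (M : Matrix ι ι ℝ) : frobNorm Mᵀ = frobNorm M :=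
  Matrix.frobenius_norm_transpose M

section Spectral

open scoped Matrix.Norms.L2Operator

theorem specNorm_nonneg (M : Matrix ι ι ℝ) : 0 ≤ specNorm M := norm_nonneg M

theorem specNorm_mul_le (M N : Matrix ι ι ℝ) : specNorm (M * N) ≤ specNorm M * specNorm N :=
  norm_mul_le M N

theorem specNorm_add_le (M N : Matrix ι ι ℝ) : specNorm (M + N) ≤ specNorm M + specNorm N :=
  norm_add_le M N

theorem specNorm_transpose (M : Matrix ι ι ℝ) : specNorm Mᵀ = specNorm M := by
  rw [← Matrix.conjTranspose_eq_transpose_of_trivial]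
  exact Matrix.l2_opNorm_conjTranspose M

theorem specNorm_diagonal_le (d : ι → ℝ) {c : ℝ} (hc : 0 ≤ c) (h : ∀ i, |d i| ≤ c) :
    specNorm (Matrix.diagonal d) ≤ c := by
  have := Matrix.l2_opNorm_diagonal (𝕜 := ℝ) d
  rw [specNorm, this]
  exact (pi_norm_le_iff_of_nonneg hc).2 h

theorem sum_sq_mulVec_le (M : Matrix ι ι ℝ) (v : ι → ℝ) :
    ∑ i, (M *ᵥ v) i ^ 2 ≤ specNorm M ^ 2 * ∑ i, v i ^ 2 := by
  have h := Matrix.l2_opNorm_mulVec M (WithLp.toLp 2 v)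
  have h2 := pow_le_pow_left₀ (norm_nonneg _) h 2
  rw [mul_pow, EuclideanSpace.norm_sq_eq, EuclideanSpace.norm_sq_eq] at h2
  simpa [specNorm] using h2

theorem specNorm_le_of_sum_sq_mulVec_le (M : Matrix ι ι ℝ) {c : ℝ} (hc : 0 ≤ c)
    (h : ∀ v : ι → ℝ, ∑ i, (M *ᵥ v) i ^ 2 ≤ c ^ 2 * ∑ i, v i ^ 2) : specNorm M ≤ c := by
  rw [specNorm, Matrix.l2_opNorm_def]
  refine ContinuousLinearMap.opNorm_le_bound _ hc fun v => ?_
  refine le_of_sq_le_sq ?_ (by positivity)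
  rw [mul_pow, EuclideanSpace.norm_sq_eq, EuclideanSpace.norm_sq_eq]
  simpa using h v.ofLp

end Spectral

theorem sum_sq_mulVec_le_frobNorm (M : Matrix ι ι ℝ) (v : ι → ℝ) :
    ∑ i, (M *ᵥ v) i ^ 2 ≤ frobNorm M ^ 2 * ∑ i, v i ^ 2 := by
  rw [frobNorm_sq, Finset.sum_mul]
  exact Finset.sum_le_sum fun i _ => Finset.sum_mul_sq_le_sq_mul_sq _ _ _

theorem specNorm_le_frobNorm (M : Matrix ι ι ℝ) : specNorm M ≤ frobNorm M :=
  specNorm_le_of_sum_sq_mulVec_le M (frobNorm_nonneg M) (sum_sq_mulVec_le_frobNorm M)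

theorem specNorm_le_one_of_orthogonal {U : Matrix ι ι ℝ} (h : Uᵀ * U = 1) : specNorm U ≤ 1 := by
  refine specNorm_le_of_sum_sq_mulVec_le _ zero_le_one fun v => ?_
  have : (U *ᵥ v) ⬝ᵥ (U *ᵥ v) = v ⬝ᵥ v := by
    rw [Matrix.dotProduct_mulVec, ← Matrix.mulVec_transpose, Matrix.mulVec_mulVec, h,
      Matrix.one_mulVec]
  simp only [dotProduct, ← sq] at this
  simp [this]

/-- The squared Frobenius norm is the sum of the squared lengths of the columns, and `M` acts on `N`
column by column. -/
theorem frobNorm_mul_le_specNorm_mul (M N : Matrix ι ι ℝ) :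
    frobNorm (M * N) ≤ specNorm M * frobNorm N := by
  refine le_of_sq_le_sq ?_ (mul_nonneg (specNorm_nonneg M) (frobNorm_nonneg N))
  rw [mul_pow, frobNorm_sq, frobNorm_sq, Finset.sum_comm, Finset.sum_comm (f := fun i j => N i j ^ 2),
    Finset.mul_sum]
  exact Finset.sum_le_sum fun j _ => sum_sq_mulVec_le M fun i => N i j

theorem frobNorm_mul_le_mul_specNorm (M N : Matrix ι ι ℝ) :
    frobNorm (M * N) ≤ frobNorm M * specNorm N := by
  rw [← frobNorm_transpose, Matrix.transpose_mul, mul_comm, ← specNorm_transpose N,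
    ← frobNorm_transpose M]
  exact frobNorm_mul_le_specNorm_mul _ _

theorem famNorm_nonneg {m : ℕ} (A : Fin m → Matrix ι ι ℝ) : 0 ≤ famNorm A := Real.sqrt_nonneg _

theorem famNorm_sq {m : ℕ} (A : Fin m → Matrix ι ι ℝ) :
    famNorm A ^ 2 = ∑ i, frobNorm (A i) ^ 2 :=
  Real.sq_sqrt (Finset.sum_nonneg fun _ _ => sq_nonneg _)

theorem famNorm_eq_norm {m : ℕ} (A : Fin m → Matrix ι ι ℝ) :
    famNorm A = ‖WithLp.toLp 2 fun i => frobNorm (A i)‖ := by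
  rw [EuclideanSpace.norm_eq, famNorm]
  simp

/-- A family that is bounded member by member by a combination of three families. -/
theorem famNorm_le_of_le {m : ℕ} (E A B : Fin m → Matrix ι ι ℝ) {a b : ℝ} (ha : 0 ≤ a) (hb : 0 ≤ b)
    (h : ∀ i, frobNorm (E i) ≤ a * frobNorm (A i) + b * frobNorm (B i)) :
    famNorm E ≤ a * famNorm A + b * famNorm B := by
  have h1 : famNorm E ≤ ‖a • WithLp.toLp 2 (fun i => frobNorm (A i))
      + b • WithLp.toLp 2 (fun i => frobNorm (B i))‖ := by
    rw [EuclideanSpace.norm_eq, famNorm]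
    refine Real.sqrt_le_sqrt (Finset.sum_le_sum fun i _ => ?_)
    rw [Real.norm_eq_abs, sq_abs]
    exact pow_le_pow_left₀ (frobNorm_nonneg _) (h i) 2
  refine h1.trans ((norm_add_le _ _).trans (le_of_eq ?_))
  rw [norm_smul, norm_smul, Real.norm_of_nonneg ha, Real.norm_of_nonneg hb, famNorm_eq_norm,
    famNorm_eq_norm]

end Norms

/-! ### Block diagonal parts -/

section Blocks

variable {t : ℕ} {s : Fin t → ℕ}

theorem bdiag_apply (M : Mat s) (x y : Idx s) : bdiag M x y = if x.1 = y.1 then M x y else 0 := by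
  obtain ⟨j, a⟩ := x
  obtain ⟨k, b⟩ := y
  by_cases h : j = k
  · subst h
    simp [bdiag, Matrix.blockDiagonal'_apply_eq, Matrix.blockDiag'_apply]
  · simp [bdiag, Matrix.blockDiagonal'_apply_ne, h]

theorem offBdiag_apply (M : Mat s) (x y : Idx s) :
    offBdiag M x y = if x.1 = y.1 then 0 else M x y := by
  rw [offBdiag, Matrix.sub_apply, bdiag_apply]
  split_ifs <;> simp

theorem mem_blockDiagSet_iff {M : Mat s} :
    M ∈ blockDiagSet s ↔ ∀ x y : Idx s, x.1 ≠ y.1 → M x y = 0 := by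
  constructor
  · intro h x y hxy
    have := congrFun (congrFun (show offBdiag M = 0 from h) x) y
    simpa [offBdiag_apply, hxy] using this
  · intro h
    refine Matrix.ext fun x y => ?_
    rw [offBdiag_apply]
    split_ifs with hxy
    · rfl
    · simpa using h x y hxy

theorem bdiag_mem (M : Mat s) : bdiag M ∈ blockDiagSet s :=
  mem_blockDiagSet_iff.2 fun x y h => by rw [bdiag_apply, if_neg h]

theorem bdiag_add_offBdiag (M : Mat s) : bdiag M + offBdiag M = M := by
  rw [offBdiag, add_sub_cancel]

theorem bdiag_add (M N : Mat s) : bdiag (M + N) = bdiag M + bdiag N := by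
  ext x y
  simp only [bdiag_apply, Matrix.add_apply]
  split_ifs <;> simp

theorem offBdiag_add (M N : Mat s) : offBdiag (M + N) = offBdiag M + offBdiag N := by
  rw [offBdiag, offBdiag, offBdiag, bdiag_add, add_sub_add_comm]

theorem frobNorm_sq_bdiag_add (M : Mat s) :
    frobNorm (bdiag M) ^ 2 + frobNorm (offBdiag M) ^ 2 = frobNorm M ^ 2 := by
  simp only [frobNorm_sq, ← Finset.sum_add_distrib, bdiag_apply, offBdiag_apply]
  refine Finset.sum_congr rfl fun x _ => Finset.sum_congr rfl fun y _ => ?_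
  split_ifs <;> simp

theorem frobNorm_bdiag_le (M : Mat s) : frobNorm (bdiag M) ≤ frobNorm M := by
  refine le_of_sq_le_sq ?_ (frobNorm_nonneg M)
  rw [← frobNorm_sq_bdiag_add M]
  exact le_add_of_nonneg_right (sq_nonneg _)

theorem frobNorm_offBdiag_le (M : Mat s) : frobNorm (offBdiag M) ≤ frobNorm M := by
  refine le_of_sq_le_sq ?_ (frobNorm_nonneg M)
  rw [← frobNorm_sq_bdiag_add M]
  exact le_add_of_nonneg_left (sq_nonneg _)

theorem blockDiagSet_mul {M N : Mat s} (hM : M ∈ blockDiagSet s) (hN : N ∈ blockDiagSet s) :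
    M * N ∈ blockDiagSet s := by
  rw [mem_blockDiagSet_iff] at *
  intro x y hxy
  rw [Matrix.mul_apply]
  refine Finset.sum_eq_zero fun z _ => ?_
  by_cases h : x.1 = z.1
  · rw [hN z y fun h' => hxy (h.trans h'), mul_zero]
  · rw [hM x z h, zero_mul]

theorem blockDiagSet_transpose {M : Mat s} (hM : M ∈ blockDiagSet s) : Mᵀ ∈ blockDiagSet s := by
  rw [mem_blockDiagSet_iff] at *
  exact fun x y hxy => hM y x fun h => hxy h.symm

theorem bdiag_mul_of_mem_left {D : Mat s} (hD : D ∈ blockDiagSet s) (M : Mat s) :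
    bdiag (D * M) = D * bdiag M := by
  rw [mem_blockDiagSet_iff] at hD
  ext x y
  rw [bdiag_apply, Matrix.mul_apply, Matrix.mul_apply]
  split_ifs with h
  · refine Finset.sum_congr rfl fun z _ => ?_
    rw [bdiag_apply]
    split_ifs with h'
    · rfl
    · rw [hD x z fun h'' => h' (h''.symm.trans h), zero_mul, zero_mul]
  · refine (Finset.sum_eq_zero fun z _ => ?_).symm
    rw [bdiag_apply]
    split_ifs with h'
    · rw [hD x z fun h'' => h (h''.trans h'), zero_mul]
    · rw [mul_zero]

theorem bdiag_transpose (M : Mat s) : bdiag Mᵀ = (bdiag M)ᵀ := by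
  ext x y
  simp only [bdiag_apply, Matrix.transpose_apply, eq_comm]

theorem bdiag_mul_of_mem_right {D : Mat s} (hD : D ∈ blockDiagSet s) (M : Mat s) :
    bdiag (M * D) = bdiag M * D := by
  rw [← Matrix.transpose_transpose (M * D), bdiag_transpose, Matrix.transpose_mul,
    bdiag_mul_of_mem_left (blockDiagSet_transpose hD), bdiag_transpose, Matrix.transpose_mul,
    Matrix.transpose_transpose, Matrix.transpose_transpose]

theorem bdiag_one : bdiag (1 : Mat s) = 1 := by
  simp [bdiag]

end Blocks

/-! ### Singular value estimates -/

section SingularValues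

variable {E F : Type*} [NormedAddCommGroup E] [InnerProductSpace ℝ E] [FiniteDimensional ℝ E]
  [NormedAddCommGroup F] [InnerProductSpace ℝ F] [FiniteDimensional ℝ F]

/-- Expand `‖T v‖² = ⟪v, T* T v⟫` in an orthonormal eigenbasis of `T* T`, whose eigenvalues are the
squared singular values. -/
theorem norm_sq_apply_eq_sum_singularValues (T : E →ₗ[ℝ] F) (v : E) :
    ‖T v‖ ^ 2 = ∑ i : Fin (Module.finrank ℝ E), T.singularValues i ^ 2 *
      (T.isSymmetric_adjoint_comp_self.eigenvectorBasis rfl).repr v i ^ 2 := by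
  set b := T.isSymmetric_adjoint_comp_self.eigenvectorBasis rfl with hb
  have h1 : ‖T v‖ ^ 2 = inner ℝ v ((LinearMap.adjoint T ∘ₗ T) v) := by
    rw [LinearMap.comp_apply, LinearMap.adjoint_inner_right, real_inner_self_eq_norm_sq]
  rw [h1, ← b.repr.inner_map_map, PiLp.inner_apply]
  refine Finset.sum_congr rfl fun i _ => ?_
  rw [hb, LinearMap.IsSymmetric.eigenvectorBasis_apply_self_apply,
    T.sq_singularValues_fin rfl]
  simp only [RCLike.inner_apply, conj_trivial, RCLike.ofReal_real_eq_id, id_eq]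
  ring

theorem mul_norm_le_norm_apply (T : E →ₗ[ℝ] F) {r : ℝ} (hr : 0 ≤ r)
    (h : ∀ i < Module.finrank ℝ E, r ≤ T.singularValues i) (v : E) : r * ‖v‖ ≤ ‖T v‖ := by
  refine le_of_sq_le_sq ?_ (norm_nonneg _)
  rw [norm_sq_apply_eq_sum_singularValues, mul_pow,
    ← (T.isSymmetric_adjoint_comp_self.eigenvectorBasis rfl).repr.norm_map v,
    EuclideanSpace.norm_sq_eq, Finset.mul_sum]
  refine Finset.sum_le_sum fun i _ => ?_
  rw [Real.norm_eq_abs, sq_abs]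
  exact mul_le_mul_of_nonneg_right (pow_le_pow_left₀ hr (h i i.2) 2) (sq_nonneg _)

/-- The distance to the kernel is controlled by the smallest nonzero singular value. -/
theorem exists_ker_mul_norm_sub_le (T : E →ₗ[ℝ] F) {r : ℝ} (hr : 0 ≤ r)
    (h : ∀ k, T.singularValues k ≠ 0 → r ≤ T.singularValues k) (v : E) :
    ∃ u, T u = 0 ∧ r * ‖v - u‖ ≤ ‖T v‖ := by
  set b := T.isSymmetric_adjoint_comp_self.eigenvectorBasis rfl with hb
  -- The kernel vector keeps the coordinates of `v` along the directions with singular value zero;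
  -- the remaining coordinates are those that `T` stretches by at least `r`.
  let c : EuclideanSpace ℝ (Fin (Module.finrank ℝ E)) :=
    WithLp.toLp 2 fun i => if T.singularValues i = 0 then b.repr v i else 0
  have hc : ∀ i, c i = if T.singularValues i = 0 then b.repr v i else 0 := fun i => rfl
  refine ⟨b.repr.symm c, ?_, ?_⟩
  · rw [← norm_eq_zero, ← sq_eq_zero_iff, norm_sq_apply_eq_sum_singularValues]
    refine Finset.sum_eq_zero fun i _ => ?_
    rw [← hb, LinearIsometryEquiv.apply_symm_apply, hc]
    split_ifs with h0 <;> simp [h0]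
  · refine le_of_sq_le_sq ?_ (norm_nonneg _)
    rw [norm_sq_apply_eq_sum_singularValues, mul_pow, ← b.repr.norm_map, map_sub,
      LinearIsometryEquiv.apply_symm_apply, EuclideanSpace.norm_sq_eq, Finset.mul_sum]
    refine Finset.sum_le_sum fun i _ => ?_
    rw [Real.norm_eq_abs, sq_abs, PiLp.sub_apply, hc]
    split_ifs with h0
    · simp [h0]
    · rw [sub_zero]
      exact mul_le_mul_of_nonneg_right (pow_le_pow_left₀ hr (h i h0) 2) (sq_nonneg _)

end SingularValues

section Matrices

variable {r c : Type*} [Fintype r] [Fintype c] [DecidableEq c]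

theorem singVal_nonneg (G : Matrix r c ℝ) (k : ℕ) : 0 ≤ singVal G k :=
  LinearMap.singularValues_nonneg _ _

theorem sigmaMin_nonneg (G : Matrix r c ℝ) : 0 ≤ sigmaMin G :=
  Real.iInf_nonneg fun _ => singVal_nonneg _ _

theorem sigmaMin_sq_mul_le (G : Matrix r c ℝ) (v : c → ℝ) :
    sigmaMin G ^ 2 * ∑ i, v i ^ 2 ≤ ∑ i, (G *ᵥ v) i ^ 2 := by
  have h := mul_norm_le_norm_apply (Matrix.toEuclideanLin G) (sigmaMin_nonneg G)
    (fun i hi => by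
      rw [finrank_euclideanSpace] at hi
      exact ciInf_le (Set.finite_range fun k : Fin (Fintype.card c) => singVal G k).bddBelow
        ⟨i, hi⟩) (WithLp.toLp 2 v)
  have h2 := pow_le_pow_left₀ (mul_nonneg (sigmaMin_nonneg G) (norm_nonneg _)) h 2
  rw [mul_pow, EuclideanSpace.norm_sq_eq, EuclideanSpace.norm_sq_eq] at h2
  simpa using h2

theorem exists_mulVec_eq_zero_sq_mul_le (G : Matrix r c ℝ) {ω : ℝ} (hω : 0 ≤ ω)
    (h : ∀ k, singVal G k ≠ 0 → ω ≤ singVal G k) (v : c → ℝ) :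
    ∃ u, G *ᵥ u = 0 ∧ ω ^ 2 * ∑ i, (v i - u i) ^ 2 ≤ ∑ i, (G *ᵥ v) i ^ 2 := by
  obtain ⟨u, hu, h1⟩ := exists_ker_mul_norm_sub_le (Matrix.toEuclideanLin G) hω h (WithLp.toLp 2 v)
  refine ⟨u.ofLp, ?_, ?_⟩
  · simpa using congrArg WithLp.ofLp hu
  have h2 := pow_le_pow_left₀ (mul_nonneg hω (norm_nonneg _)) h1 2
  rw [mul_pow, EuclideanSpace.norm_sq_eq, EuclideanSpace.norm_sq_eq] at h2
  simpa using h2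

end Matrices

/-! ### The matrices `G_{jk}` as operators -/

section FrobeniusBlocks

open scoped Matrix.Norms.Frobenius

theorem sum_sq_vec {ι κ : Type*} [Fintype ι] [Fintype κ] (X : Matrix ι κ ℝ) :
    ∑ p, Matrix.vec X p ^ 2 = ‖X‖ ^ 2 := by
  rw [frobenius_norm_sq, Fintype.sum_prod_type, Finset.sum_comm]
  simp [Matrix.vec]

/-- Through `vec`, `offG A B` encodes the pair of maps `(X, Y) ↦ (A_i X - Y B_i, A_iᵀ X - Y B_iᵀ)`.
The matrix carries plus signs, so it is applied to the vector of `X` and `-Y`. -/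
theorem sigmaMin_offG_sq_mul_le {ι κ : Type*} [Fintype ι] [Fintype κ] [DecidableEq ι]
    [DecidableEq κ] {m : ℕ} (A : Fin m → Matrix ι ι ℝ) (B : Fin m → Matrix κ κ ℝ)
    (X Y : Matrix ι κ ℝ) :
    sigmaMin (offG A B) ^ 2 * (‖X‖ ^ 2 + ‖Y‖ ^ 2)
      ≤ ∑ i, (‖A i * X - Y * B i‖ ^ 2 + ‖(A i)ᵀ * X - Y * (B i)ᵀ‖ ^ 2) := by
  have h := sigmaMin_sq_mul_le (offG A B) (Sum.elim (Matrix.vec X) (Matrix.vec (-Y)))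
  rw [Fintype.sum_sum_type] at h
  simp only [Sum.elim_inl, Sum.elim_inr] at h
  rw [sum_sq_vec, sum_sq_vec, norm_neg, Fintype.sum_prod_type] at h
  refine h.trans (le_of_eq (Finset.sum_congr rfl fun i _ => ?_))
  have key : (fun q => (offG A B *ᵥ Sum.elim (Matrix.vec X) (Matrix.vec (-Y))) (i, q))
      = Sum.elim (Matrix.vec (A i * X - Y * B i)) (Matrix.vec ((A i)ᵀ * X - Y * (B i)ᵀ)) := by
    have : (fun q => (offG A B *ᵥ Sum.elim (Matrix.vec X) (Matrix.vec (-Y))) (i, q))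
      = Matrix.fromBlocks
      ((1 : Matrix κ κ ℝ) ⊗ₖ A i) ((B i)ᵀ ⊗ₖ (1 : Matrix ι ι ℝ))
      ((1 : Matrix κ κ ℝ) ⊗ₖ (A i)ᵀ) (B i ⊗ₖ (1 : Matrix ι ι ℝ)) *ᵥ
        Sum.elim (Matrix.vec X) (Matrix.vec (-Y)) := rfl
    rw [this, Matrix.fromBlocks_mulVec]
    simp only [Sum.elim_comp_inl, Sum.elim_comp_inr, Matrix.kronecker_mulVec_vec,
      Matrix.transpose_one, Matrix.mul_one, Matrix.one_mul, Matrix.transpose_transpose,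
      ← Matrix.vec_add, Matrix.neg_mul, ← sub_eq_add_neg]
  rw [Fintype.sum_sum_type]
  have h1 : ∀ q, (offG A B *ᵥ Sum.elim (Matrix.vec X) (Matrix.vec (-Y))) (i, q) = _ :=
    fun q => congrFun key q
  simp only [h1, Sum.elim_inl, Sum.elim_inr, sum_sq_vec]

theorem shuffle_mulVec_vec {ι : Type*} [Fintype ι] [DecidableEq ι] (Z : Matrix ι ι ℝ) :
    shuffle ι *ᵥ Matrix.vec Z = Matrix.vec Zᵀ := by
  ext p
  simp [shuffle, Matrix.mulVec, dotProduct, Matrix.vec]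

theorem diagG_mulVec_vec {ι : Type*} [Fintype ι] [DecidableEq ι] {m : ℕ}
    (A : Fin m → Matrix ι ι ℝ) (Z : Matrix ι ι ℝ) (i : Fin m) :
    (fun q => (diagG A *ᵥ Matrix.vec Z) (i, q)) = Matrix.vec (A i * Z - Zᵀ * A i) := by
  have : (fun q => (diagG A *ᵥ Matrix.vec Z) (i, q))
      = ((1 : Matrix ι ι ℝ) ⊗ₖ A i - ((A i)ᵀ ⊗ₖ (1 : Matrix ι ι ℝ)) * shuffle ι) *ᵥ
        Matrix.vec Z := rfl
  rw [this, Matrix.sub_mulVec, ← Matrix.mulVec_mulVec, shuffle_mulVec_vec]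
  simp only [Matrix.kronecker_mulVec_vec, Matrix.transpose_one, Matrix.mul_one, Matrix.one_mul,
    Matrix.transpose_transpose, ← Matrix.vec_sub]

/-- `diagG A` represents `Z ↦ A_i Z - Zᵀ A_i`, so its kernel is `nullSpace A`, and the smallest
nonzero singular value controls the distance to it. -/
theorem exists_mem_nullSpace_sq_mul_le {ι : Type*} [Fintype ι] [DecidableEq ι] {m : ℕ}
    (A : Fin m → Matrix ι ι ℝ) (Z : Matrix ι ι ℝ) {ω : ℝ} (hω : 0 ≤ ω)
    (h : ∀ k, singVal (diagG A) k ≠ 0 → ω ≤ singVal (diagG A) k) :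
    ∃ N ∈ nullSpace A, ω ^ 2 * ‖Z - N‖ ^ 2 ≤ ∑ i, ‖A i * Z - Zᵀ * A i‖ ^ 2 := by
  obtain ⟨u, hu, h1⟩ := exists_mulVec_eq_zero_sq_mul_le (diagG A) hω h (Matrix.vec Z)
  obtain ⟨N, rfl⟩ := Matrix.vec_bijective.2 u
  refine ⟨N, fun i => ?_, ?_⟩
  · rw [← Matrix.vec_eq_zero_iff, ← diagG_mulVec_vec, hu]
    rfl
  · have h2 : ∀ p, Matrix.vec Z p - Matrix.vec N p = Matrix.vec (Z - N) p := fun p => rfl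
    have h3 : ∀ i q, (diagG A *ᵥ Matrix.vec Z) (i, q) = Matrix.vec (A i * Z - Zᵀ * A i) q :=
      fun i q => congrFun (diagG_mulVec_vec A Z i) q
    simp only [h2] at h1
    rw [sum_sq_vec, Fintype.sum_prod_type] at h1
    simpa only [h3, sum_sq_vec] using h1

/-- The identity always belongs to `nullSpace A`, so it spans this space as soon as the dimension is
one. -/
theorem exists_scalar_of_finrank_nullSpace {ι : Type*} [Fintype ι] [DecidableEq ι] [Nonempty ι]
    {m : ℕ} {A : Fin m → Matrix ι ι ℝ} (h : Module.finrank ℝ (nullSpace A) = 1)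
    {N : Matrix ι ι ℝ} (hN : N ∈ nullSpace A) : ∃ z : ℝ, N = z • (1 : Matrix ι ι ℝ) := by
  have h1 : (1 : Matrix ι ι ℝ) ∈ nullSpace A := fun i => by simp
  obtain ⟨z, hz⟩ := (finrank_eq_one_iff_of_nonzero' (⟨1, h1⟩ : nullSpace A)
    (by simp [Subtype.ext_iff])).1 h ⟨N, hN⟩
  exact ⟨z, by simpa using (congrArg Subtype.val hz).symm⟩

/-! ### Blocks of the commutator-like residual -/

section Blocks

variable {t : ℕ} {s : Fin t → ℕ}

/-- The block `M_{jk}`. -/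
def blk (M : Mat s) (j k : Fin t) : Matrix (Fin (s j)) (Fin (s k)) ℝ :=
  M.submatrix (fun a => ⟨j, a⟩) (fun b => ⟨k, b⟩)

theorem blk_apply (M : Mat s) (j k : Fin t) (a : Fin (s j)) (b : Fin (s k)) :
    blk M j k a b = M ⟨j, a⟩ ⟨k, b⟩ := rfl

theorem blk_sub (M N : Mat s) (j k : Fin t) : blk (M - N) j k = blk M j k - blk N j k := rfl

theorem blk_transpose (M : Mat s) (j k : Fin t) : blk Mᵀ j k = (blk M k j)ᵀ := rfl

theorem blk_mul_of_mem {D : Mat s} (hD : D ∈ blockDiagSet s) (M : Mat s) (j k : Fin t) :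
    blk (D * M) j k = Matrix.blockDiag' D j * blk M j k := by
  rw [mem_blockDiagSet_iff] at hD
  ext a b
  rw [blk_apply, Matrix.mul_apply, Matrix.mul_apply, Fintype.sum_sigma]
  rw [Finset.sum_eq_single j]
  · rfl
  · intro l _ hl
    exact Finset.sum_eq_zero fun c _ => by rw [hD ⟨j, a⟩ ⟨l, c⟩ hl.symm, zero_mul]
  · simp

theorem blk_mul_of_mem_right {D : Mat s} (hD : D ∈ blockDiagSet s) (M : Mat s) (j k : Fin t) :
    blk (M * D) j k = blk M j k * Matrix.blockDiag' D k := by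
  have := blk_mul_of_mem (blockDiagSet_transpose hD) Mᵀ k j
  rw [← Matrix.transpose_mul, blk_transpose, blk_transpose, Matrix.blockDiag'_transpose,
    ← Matrix.transpose_mul] at this
  exact Matrix.transpose_injective this

theorem frobNorm_sq_eq_sum_blk (M : Mat s) : frobNorm M ^ 2 = ∑ j, ∑ k, ‖blk M j k‖ ^ 2 := by
  simp only [frobNorm_sq, frobenius_norm_sq, Fintype.sum_sigma, Real.norm_eq_abs, sq_abs, blk_apply]
  exact Finset.sum_congr rfl fun j _ => Finset.sum_comm

theorem frobNorm_sq_offBdiag_eq_sum_blk (M : Mat s) :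
    frobNorm (offBdiag M) ^ 2 = ∑ j, ∑ k, if j = k then 0 else ‖blk M j k‖ ^ 2 := by
  rw [frobNorm_sq_eq_sum_blk]
  refine Finset.sum_congr rfl fun j _ => Finset.sum_congr rfl fun k _ => ?_
  rw [frobenius_norm_sq, frobenius_norm_sq]
  split_ifs with h <;> simp [blk_apply, offBdiag_apply, h]

/-- A symmetric pairing of nonnegative contributions. -/
theorem sum_sum_nonneg_of_add_swap_nonneg {ι : Type*} [Fintype ι] (f : ι → ι → ℝ)
    (h : ∀ j k, 0 ≤ f j k + f k j) : 0 ≤ ∑ j, ∑ k, f j k := by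
  have h1 : 0 ≤ ∑ j, ∑ k, (f j k + f k j) :=
    Finset.sum_nonneg fun j _ => Finset.sum_nonneg fun k _ => h j k
  simp only [Finset.sum_add_distrib] at h1
  rw [Finset.sum_comm (f := fun j k => f k j)] at h1
  linarith

variable {m : ℕ} {A : Fin m → Mat s} {W : Mat s}

theorem omegaUniq_nonneg : 0 ≤ omegaUniq A W := Real.iInf_nonneg fun _ => sigmaMin_nonneg _

/-- Because `Wᵀ A_i W` is block diagonal, the blocks `(j, k)` and `(k, j)` of the defect involve
only `Z_jk` and `Z_kj`. Transposing the second block brings the pair into the form governed by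
`G_jk` at `X = Z_jk`, `Y = Z_kjᵀ`. Only pairs `j < k` enter the modulus, so the contributions of
`(j, k)` and `(k, j)` are summed together. -/
theorem omegaUniq_mul_frobNorm_offBdiag_le (hW : IsBlockDiagonalizer A W) (Z : Mat s) :
    omegaUniq A W * frobNorm (offBdiag Z)
      ≤ famNorm fun i => Wᵀ * A i * W * Z - Zᵀ * (Wᵀ * A i * W) := by
  set E : Fin m → Mat s := fun i => Wᵀ * A i * W * Z - Zᵀ * (Wᵀ * A i * W) with hE
  have hblk : ∀ i j k, blk (E i) j k
      = diagBlocks A W j i * blk Z j k - (blk Z k j)ᵀ * diagBlocks A W k i := fun i j k => by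
    rw [hE, blk_sub, blk_mul_of_mem (hW.2 i), blk_mul_of_mem_right (hW.2 i), blk_transpose]
    rfl
  have hlt : ∀ j k : Fin t, j < k → omegaUniq A W ^ 2 * (‖blk Z j k‖ ^ 2 + ‖blk Z k j‖ ^ 2)
      ≤ ∑ i, (‖blk (E i) j k‖ ^ 2 + ‖blk (E i) k j‖ ^ 2) := fun j k hjk => by
    have h1 : omegaUniq A W ≤ sigmaMin (offG (diagBlocks A W j) (diagBlocks A W k)) :=
      ciInf_le (Set.finite_range fun p : {p : Fin t × Fin t // p.1 < p.2} =>
        sigmaMin (offG (diagBlocks A W p.1.1) (diagBlocks A W p.1.2))).bddBelow ⟨(j, k), hjk⟩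
    have h2 := sigmaMin_offG_sq_mul_le (diagBlocks A W j) (diagBlocks A W k) (blk Z j k)
      (blk Z k j)ᵀ
    rw [Matrix.frobenius_norm_transpose] at h2
    refine (mul_le_mul_of_nonneg_right (pow_le_pow_left₀ omegaUniq_nonneg h1 2)
      (by positivity)).trans (h2.trans (le_of_eq ?_))
    refine Finset.sum_congr rfl fun i _ => ?_
    rw [hblk, hblk, ← Matrix.frobenius_norm_transpose (diagBlocks A W k i * _ - _),
      Matrix.transpose_sub, Matrix.transpose_mul, Matrix.transpose_mul,
      Matrix.transpose_transpose, norm_sub_rev ((blk Z k j)ᵀ * _)]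
  refine le_of_sq_le_sq ?_ (famNorm_nonneg _)
  rw [mul_pow, famNorm_sq, frobNorm_sq_offBdiag_eq_sum_blk]
  simp only [frobNorm_sq_eq_sum_blk]
  have h3 := sum_sum_nonneg_of_add_swap_nonneg (fun j k : Fin t => (∑ i, ‖blk (E i) j k‖ ^ 2)
    - omegaUniq A W ^ 2 * if j = k then 0 else ‖blk Z j k‖ ^ 2) (fun j k => by
      rcases lt_trichotomy j k with h | h | h
      · have := hlt j k h
        rw [Finset.sum_add_distrib] at this
        rw [if_neg h.ne, if_neg h.ne']
        linarith
      · subst h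
        simp only [if_true, mul_zero, sub_zero]
        positivity
      · have := hlt k j h
        rw [Finset.sum_add_distrib] at this
        rw [if_neg h.ne, if_neg h.ne']
        linarith)
  simp only [Finset.sum_sub_distrib, ← Finset.mul_sum] at h3
  have h4 : ∑ j, ∑ k, ∑ i, ‖blk (E i) j k‖ ^ 2 = ∑ i, ∑ j, ∑ k, ‖blk (E i) j k‖ ^ 2 := by
    rw [Finset.sum_comm (s := (Finset.univ : Finset (Fin m)))]
    exact Finset.sum_congr rfl fun j _ => Finset.sum_comm
  rw [← h4]
  linarith

theorem exists_scalar_mul_norm_blk_sub_le (hW : IsBlockDiagonalizer A W) (Z : Mat s) {j : Fin t}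
    (hj : 0 < s j) (hdim : Module.finrank ℝ (nullSpace (diagBlocks A W j)) = 1) {ω : ℝ} (hω : 0 ≤ ω)
    (h : ∀ k, singVal (diagG (diagBlocks A W j)) k ≠ 0 →
      ω ≤ singVal (diagG (diagBlocks A W j)) k) :
    ∃ z : ℝ, ω * ‖blk Z j j - z • (1 : Matrix (Fin (s j)) (Fin (s j)) ℝ)‖
      ≤ famNorm fun i => Wᵀ * A i * W * Z - Zᵀ * (Wᵀ * A i * W) := by
  have : Nonempty (Fin (s j)) := ⟨⟨0, hj⟩⟩
  obtain ⟨N, hN, h1⟩ := exists_mem_nullSpace_sq_mul_le _ (blk Z j j) hω h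
  obtain ⟨z, rfl⟩ := exists_scalar_of_finrank_nullSpace hdim hN
  refine ⟨z, le_of_sq_le_sq ?_ (famNorm_nonneg _)⟩
  rw [mul_pow, famNorm_sq]
  refine h1.trans (Finset.sum_le_sum fun i _ => ?_)
  have hblk : diagBlocks A W j i * blk Z j j - (blk Z j j)ᵀ * diagBlocks A W j i
      = blk (Wᵀ * A i * W * Z - Zᵀ * (Wᵀ * A i * W)) j j := by
    rw [blk_sub, blk_mul_of_mem (hW.2 i), blk_mul_of_mem_right (hW.2 i), blk_transpose]
    rfl
  rw [hblk, frobNorm_sq_eq_sum_blk]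
  refine le_trans ?_ (Finset.single_le_sum (f := fun a => ∑ k,
    ‖blk (Wᵀ * A i * W * Z - Zᵀ * (Wᵀ * A i * W)) a k‖ ^ 2) (fun a _ => by positivity)
    (Finset.mem_univ j))
  exact Finset.single_le_sum (f := fun k =>
    ‖blk (Wᵀ * A i * W * Z - Zᵀ * (Wᵀ * A i * W)) j k‖ ^ 2) (fun a _ => by positivity)
    (Finset.mem_univ j)

end Blocks

end FrobeniusBlocks

/-! ### The residual of the transformed diagonalizer -/

section Residual

variable {t : ℕ} {s : Fin t → ℕ} {m : ℕ}

theorem specNorm_gammaMat_le {γ : Fin t → ℝ} (hγ : ∀ j, |γ j| ≤ 1) : specNorm (gammaMat s γ) ≤ 1 :=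
  specNorm_diagonal_le _ zero_le_one fun x => hγ x.1

/-- With `V = Q⁻¹` one has `W' V = W`, so congruence by `V` turns the residual of `W'` for the
perturbed family into the defect of `Z`, up to replacing `A'` by `A`. This replacement costs two
terms, each with one factor `W` and one factor `W' Γ V`; as `‖Γ‖₂ ≤ 1`, they account for the `2` in
`delta`. -/
theorem famNorm_residual_le_delta (A A' : Fin m → Mat s) {W W' : Mat s} {γ : Fin t → ℝ}
    (hW : IsUnit W) (hW' : IsUnit W') (hγ : ∀ j, |γ j| ≤ 1) :
    (famNorm fun i => Wᵀ * A i * W * (W⁻¹ * W' * gammaMat s γ * (W⁻¹ * W')⁻¹)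
        - (W⁻¹ * W' * gammaMat s γ * (W⁻¹ * W')⁻¹)ᵀ * (Wᵀ * A i * W))
      ≤ delta A A' W W' γ := by
  have hdet := (Matrix.isUnit_iff_isUnit_det _).1 hW
  have hdet' := (Matrix.isUnit_iff_isUnit_det _).1 hW'
  set V := (W⁻¹ * W')⁻¹ with hV
  set Γ := gammaMat s γ with hΓ
  have hVW : W' * V = W := by
    rw [hV, Matrix.mul_inv_rev, Matrix.nonsing_inv_nonsing_inv _ hdet, ← Matrix.mul_assoc,
      Matrix.mul_nonsing_inv _ hdet', Matrix.one_mul]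
  have hWZ : W * (W⁻¹ * W' * Γ * V) = W' * Γ * V := by
    simp only [← Matrix.mul_assoc]
    rw [Matrix.mul_nonsing_inv _ hdet, Matrix.one_mul]
  have hWZ' : (W⁻¹ * W' * Γ * V)ᵀ * Wᵀ = (W' * Γ * V)ᵀ := by
    rw [← Matrix.transpose_mul, hWZ]
  have hΓt : Γᵀ = Γ := Matrix.diagonal_transpose _
  have key : ∀ i, Wᵀ * A i * W * (W⁻¹ * W' * Γ * V) - (W⁻¹ * W' * Γ * V)ᵀ * (Wᵀ * A i * W)
      = Vᵀ * residual A' W' γ i * V - (Wᵀ * (A' i - A i) * (W' * Γ * V)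
        - (W' * Γ * V)ᵀ * (A' i - A i) * W) := fun i => by
    rw [Matrix.mul_assoc (Wᵀ * A i), hWZ, Matrix.mul_assoc Wᵀ (A i) W, ← Matrix.mul_assoc _ Wᵀ, hWZ',
      residual, ← hΓ]
    have h1 : Wᵀ = Vᵀ * W'ᵀ := by rw [← Matrix.transpose_mul, hVW]
    have h2 : (W' * Γ * V)ᵀ = Vᵀ * Γ * W'ᵀ := by
      rw [Matrix.transpose_mul, Matrix.transpose_mul, hΓt, Matrix.mul_assoc]
    rw [h1, h2, ← hVW]
    noncomm_ring
  have hR : specNorm (W' * Γ * V) ≤ specNorm W' * specNorm V := by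
    refine (specNorm_mul_le _ _).trans (mul_le_mul_of_nonneg_right ?_ (specNorm_nonneg _))
    refine (specNorm_mul_le _ _).trans ?_
    exact mul_le_of_le_one_right (specNorm_nonneg _) (specNorm_gammaMat_le hγ)
  have h3 : ∀ (B C D : Mat s), frobNorm (B * C * D) ≤ specNorm B * specNorm D * frobNorm C :=
    fun B C D => by
      refine (frobNorm_mul_le_mul_specNorm _ _).trans ?_
      refine (mul_le_mul_of_nonneg_right (frobNorm_mul_le_specNorm_mul B C)
        (specNorm_nonneg _)).trans (le_of_eq (by ring))
  refine (famNorm_le_of_le _ (residual A' W' γ) (fun i => A' i - A i)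
    (a := specNorm V ^ 2) (b := 2 * specNorm V * specNorm W * specNorm W') (by positivity)
    (by have := specNorm_nonneg V; have := specNorm_nonneg W; have := specNorm_nonneg W'; positivity)
    fun i => ?_).trans (le_of_eq rfl)
  rw [key]
  have hF := frobNorm_nonneg (A' i - A i)
  have h4 : frobNorm (Vᵀ * residual A' W' γ i * V)
      ≤ specNorm V ^ 2 * frobNorm (residual A' W' γ i) := by
    refine (h3 _ _ _).trans (le_of_eq ?_)
    rw [specNorm_transpose, sq]
  have h5 : frobNorm (Wᵀ * (A' i - A i) * (W' * Γ * V))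
      ≤ specNorm W * (specNorm W' * specNorm V) * frobNorm (A' i - A i) := by
    refine (h3 _ _ _).trans ?_
    rw [specNorm_transpose]
    exact mul_le_mul_of_nonneg_right (mul_le_mul_of_nonneg_left hR (specNorm_nonneg _)) hF
  have h6 : frobNorm ((W' * Γ * V)ᵀ * (A' i - A i) * W)
      ≤ specNorm W * (specNorm W' * specNorm V) * frobNorm (A' i - A i) := by
    refine (h3 _ _ _).trans ?_
    rw [specNorm_transpose, mul_comm (specNorm (W' * Γ * V))]
    exact mul_le_mul_of_nonneg_right (mul_le_mul_of_nonneg_left hR (specNorm_nonneg _)) hF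
  refine (frobNorm_sub_le _ _).trans ((add_le_add h4 (frobNorm_sub_le _ _)).trans ?_)
  linarith

end Residual

/-! ### Block diagonalization of a perturbation of `Γ` -/

section Riccati

variable {t : ℕ} {s : Fin t → ℕ}

/-- The inverse, on matrices with zero diagonal blocks, of `P ↦ Γ P - P Γ`; division by zero
annihilates the diagonal blocks. -/
def sylvesterInv (γ : Fin t → ℝ) (M : Mat s) : Mat s :=
  Matrix.of fun x y => M x y / (γ x.1 - γ y.1)

theorem sylvesterInv_apply (γ : Fin t → ℝ) (M : Mat s) (x y : Idx s) :
    sylvesterInv γ M x y = M x y / (γ x.1 - γ y.1) := rfl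

theorem sylvesterInv_sub (γ : Fin t → ℝ) (M N : Mat s) :
    sylvesterInv γ (M - N) = sylvesterInv γ M - sylvesterInv γ N := by
  ext x y
  simp only [sylvesterInv_apply, Matrix.sub_apply, sub_div]

theorem bdiag_sylvesterInv (γ : Fin t → ℝ) (M : Mat s) : bdiag (sylvesterInv γ M) = 0 := by
  ext x y
  rw [bdiag_apply, sylvesterInv_apply]
  split_ifs with h <;> simp [h]

theorem mul_frobNorm_sylvesterInv_le {γ : Fin t → ℝ} {g : ℝ} (hg : 0 < g)
    (hγ : ∀ j k, j ≠ k → g ≤ |γ j - γ k|) (M : Mat s) :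
    g * frobNorm (sylvesterInv γ M) ≤ frobNorm M := by
  refine le_of_sq_le_sq ?_ (frobNorm_nonneg _)
  rw [mul_pow, frobNorm_sq, frobNorm_sq, Finset.mul_sum]
  refine Finset.sum_le_sum fun x _ => ?_
  rw [Finset.mul_sum]
  refine Finset.sum_le_sum fun y _ => ?_
  rw [sylvesterInv_apply]
  by_cases h : x.1 = y.1
  · simp [h, sq_nonneg]
  · have h1 := hγ _ _ h
    have h2 : g ^ 2 ≤ (γ x.1 - γ y.1) ^ 2 := by
      rw [← sq_abs (γ x.1 - γ y.1)]
      exact pow_le_pow_left₀ hg.le h1 2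
    have h3 : 0 < (γ x.1 - γ y.1) ^ 2 := lt_of_lt_of_le (by positivity) h2
    rw [div_pow, mul_div_assoc', div_le_iff₀ h3]
    nlinarith [sq_nonneg (M x y)]

theorem gammaMat_commutator_apply (γ : Fin t → ℝ) (P : Mat s) (x y : Idx s) :
    (gammaMat s γ * P - P * gammaMat s γ) x y = (γ x.1 - γ y.1) * P x y := by
  rw [Matrix.sub_apply, gammaMat, Matrix.diagonal_mul, Matrix.mul_diagonal]
  ring

/-- The map whose fixed points block diagonalize `Γ + E`. -/
def riccatiMap (γ : Fin t → ℝ) (E P : Mat s) : Mat s :=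
  sylvesterInv γ (P * bdiag (E * (1 + P)) - offBdiag (E * (1 + P)))

theorem bdiag_mul_eq_zero {P B : Mat s} (hP : bdiag P = 0) (hB : B ∈ blockDiagSet s) :
    bdiag (P * B) = 0 := by
  rw [bdiag_mul_of_mem_right hB, hP, Matrix.zero_mul]

/-- Let `B` and `O` be the diagonal and off-diagonal parts of `E (1 + P)`. The intertwining relation
amounts to `Γ P - P Γ = P B - O`. Off the diagonal blocks this is the fixed point equation
multiplied by `γ_j - γ_k`; on them both sides vanish, since `P` has zero diagonal blocks. -/
theorem add_mul_one_add_eq_of_isFixedPt {γ : Fin t → ℝ} (hγ : Function.Injective γ) {E P : Mat s}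
    (h : riccatiMap γ E P = P) :
    bdiag P = 0 ∧ (gammaMat s γ + E) * (1 + P) = (1 + P) * (gammaMat s γ + bdiag (E * (1 + P))) := by
  have h0 : bdiag P = 0 := by rw [← h]; exact bdiag_sylvesterInv _ _
  refine ⟨h0, ?_⟩
  have h1 : gammaMat s γ * P - P * gammaMat s γ
      = P * bdiag (E * (1 + P)) - offBdiag (E * (1 + P)) := by
    ext x y
    rw [gammaMat_commutator_apply]
    by_cases hxy : x.1 = y.1
    · rw [hxy, sub_self, zero_mul, Matrix.sub_apply, offBdiag_apply, if_pos hxy, sub_zero]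
      have := congrFun (congrFun (bdiag_mul_eq_zero h0 (bdiag_mem (E * (1 + P)))) x) y
      rw [bdiag_apply, if_pos hxy] at this
      exact this.symm
    · have h2 : γ x.1 - γ y.1 ≠ 0 := sub_ne_zero.2 fun h' => hxy (hγ h')
      conv_lhs => rw [← h]
      rw [riccatiMap, sylvesterInv_apply, mul_div_cancel₀ _ h2]
  have h3 := bdiag_add_offBdiag (E * (1 + P))
  generalize bdiag (E * (1 + P)) = B at h1 h3 ⊢
  generalize offBdiag (E * (1 + P)) = O at h1 h3
  have h4 : gammaMat s γ * P = P * gammaMat s γ + (P * B - O) := by rw [← h1]; abel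
  rw [add_mul, ← h3, mul_add, mul_one, h4]
  noncomm_ring

theorem frobNorm_mul_one_add_le (E P : Mat s) :
    frobNorm (E * (1 + P)) ≤ frobNorm E * (1 + frobNorm P) := by
  rw [mul_add, mul_one, mul_add, mul_one]
  exact (frobNorm_add_le _ _).trans (add_le_add le_rfl (frobNorm_mul_le _ _))

theorem mul_frobNorm_riccatiMap_le {γ : Fin t → ℝ} {g : ℝ} (hg : 0 < g)
    (hγ : ∀ j k, j ≠ k → g ≤ |γ j - γ k|) (E P : Mat s) {x : ℝ} (hx : x ≤ √2 - 1)
    (hP : frobNorm P ≤ x) :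
    g * frobNorm (riccatiMap γ E P) ≤ frobNorm E * (1 + √2 * x + x ^ 2 / 2) := by
  refine (mul_frobNorm_sylvesterInv_le hg hγ _).trans ((frobNorm_sub_le _ _).trans ?_)
  have hp := frobNorm_nonneg P
  have he := frobNorm_nonneg E
  have hx0 : 0 ≤ x := hp.trans hP
  have h1 : frobNorm (E * P) ≤ frobNorm E * x :=
    (frobNorm_mul_le _ _).trans (mul_le_mul_of_nonneg_left hP he)
  have h2 : frobNorm (P * bdiag (E * (1 + P))) ≤ x * (frobNorm (bdiag E) + frobNorm E * x) := by
    refine (frobNorm_mul_le _ _).trans (mul_le_mul hP ?_ (frobNorm_nonneg _) hx0)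
    rw [mul_add, mul_one, bdiag_add]
    exact (frobNorm_add_le _ _).trans
      (add_le_add le_rfl ((frobNorm_bdiag_le _).trans h1))
  have h3 : frobNorm (offBdiag (E * (1 + P))) ≤ frobNorm (offBdiag E) + frobNorm E * x := by
    rw [mul_add, mul_one, offBdiag_add]
    exact (frobNorm_add_le _ _).trans
      (add_le_add le_rfl ((frobNorm_offBdiag_le _).trans h1))
  -- Cauchy–Schwarz with `‖Bdiag E‖² + ‖OffBdiag E‖² = ‖E‖²` gives the factor `√(1 + x²) ≤ 1 + x² /
  -- 2`. Bounding both parts separately by `‖E‖` would lose too much for the stated constants.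
  have h4 : x * frobNorm (bdiag E) + frobNorm (offBdiag E) ≤ frobNorm E * (1 + x ^ 2 / 2) := by
    refine abs_le_of_sq_le_sq' ?_ (by positivity) |>.2
    have h5 := frobNorm_sq_bdiag_add E
    have h6 : (x * frobNorm (bdiag E) + frobNorm (offBdiag E)) ^ 2
        ≤ (1 + x ^ 2) * frobNorm E ^ 2 := by
      rw [← h5]
      nlinarith [sq_nonneg (frobNorm (bdiag E) - x * frobNorm (offBdiag E))]
    nlinarith [mul_nonneg (sq_nonneg (frobNorm E)) (sq_nonneg (x ^ 2))]
  -- The condition `x ≤ √2 - 1` trades the quadratic term for `(√2 - 1) x`, which together with the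
  -- linear term `x` gives `√2 x`.
  have h7 : frobNorm E * x ^ 2 ≤ frobNorm E * (x * (√2 - 1)) := by
    refine mul_le_mul_of_nonneg_left ?_ he
    nlinarith
  nlinarith

/-- The map is quadratic in `P`. Splitting the difference of the products `P B(P)` leaves one term
with `P - P'` outside and one with it inside the block diagonal part; together with the off-diagonal
part they contribute `1 + x`, `x` and `1`. -/
theorem mul_frobNorm_riccatiMap_sub_le {γ : Fin t → ℝ} {g : ℝ} (hg : 0 < g)
    (hγ : ∀ j k, j ≠ k → g ≤ |γ j - γ k|) (E P P' : Mat s) {x : ℝ}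
    (hP : frobNorm P ≤ x) (hP' : frobNorm P' ≤ x) :
    g * frobNorm (riccatiMap γ E P - riccatiMap γ E P')
      ≤ frobNorm E * (2 + 2 * x) * frobNorm (P - P') := by
  rw [riccatiMap, riccatiMap, ← sylvesterInv_sub]
  refine (mul_frobNorm_sylvesterInv_le hg hγ _).trans ?_
  have h0 : E * (1 + P) = E * (P - P') + E * (1 + P') := by noncomm_ring
  have h1 : P * bdiag (E * (1 + P)) - offBdiag (E * (1 + P))
      - (P' * bdiag (E * (1 + P')) - offBdiag (E * (1 + P')))
      = ((P - P') * bdiag (E * (1 + P)) + P' * bdiag (E * (P - P'))) - offBdiag (E * (P - P')) := by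
    have hb : bdiag (E * (P - P')) = bdiag (E * (1 + P)) - bdiag (E * (1 + P')) := by
      rw [h0, bdiag_add, add_sub_cancel_right]
    have ho : offBdiag (E * (P - P')) = offBdiag (E * (1 + P)) - offBdiag (E * (1 + P')) := by
      rw [h0, offBdiag_add, add_sub_cancel_right]
    rw [hb, ho]
    noncomm_ring
  rw [h1]
  have he := frobNorm_nonneg E
  have hd := frobNorm_nonneg (P - P')
  have hx0 : 0 ≤ x := (frobNorm_nonneg P).trans hP
  have h2 : frobNorm (E * (P - P')) ≤ frobNorm E * frobNorm (P - P') := frobNorm_mul_le _ _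
  have h3 : frobNorm ((P - P') * bdiag (E * (1 + P)))
      ≤ frobNorm (P - P') * (frobNorm E * (1 + x)) := by
    refine (frobNorm_mul_le _ _).trans (mul_le_mul_of_nonneg_left ?_ hd)
    refine (frobNorm_bdiag_le _).trans ((frobNorm_mul_one_add_le _ _).trans ?_)
    exact mul_le_mul_of_nonneg_left (by linarith) he
  have h4 : frobNorm (P' * bdiag (E * (P - P'))) ≤ x * (frobNorm E * frobNorm (P - P')) :=
    (frobNorm_mul_le _ _).trans
      (mul_le_mul hP' ((frobNorm_bdiag_le _).trans h2) (frobNorm_nonneg _) hx0)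
  refine (frobNorm_sub_le _ _).trans ?_
  refine (add_le_add ((frobNorm_add_le _ _).trans (add_le_add h3 h4))
    ((frobNorm_offBdiag_le _).trans h2)).trans (le_of_eq (by ring))

open scoped Matrix.Norms.Frobenius in
/-- A small perturbation of `Γ` is block diagonalized by a matrix close to the identity. -/
theorem exists_block_diagonalization {γ : Fin t → ℝ} (hinj : Function.Injective γ) {g : ℝ}
    (hg : 0 < g) (hγ : ∀ j k, j ≠ k → g ≤ |γ j - γ k|) (E : Mat s) {x : ℝ} (hx0 : 0 ≤ x)
    (hx : x ≤ √2 - 1) (hball : frobNorm E * (1 + √2 * x + x ^ 2 / 2) ≤ g * x)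
    (hcontr : frobNorm E * (2 + 2 * x) < g) :
    ∃ P : Mat s, frobNorm P ≤ x ∧ bdiag P = 0 ∧
      (gammaMat s γ + E) * (1 + P) = (1 + P) * (gammaMat s γ + bdiag (E * (1 + P))) := by
  set S : Set (Mat s) := Metric.closedBall 0 x with hS
  have hmem : ∀ P : Mat s, P ∈ S ↔ frobNorm P ≤ x := fun P => by
    rw [hS, mem_closedBall_zero_iff]
    rfl
  have hmaps : Set.MapsTo (riccatiMap γ E) S S := fun P hP => by
    rw [hmem] at hP ⊢
    exact le_of_mul_le_mul_left ((mul_frobNorm_riccatiMap_le hg hγ E P hx hP).trans hball) hg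
  have hK : 0 ≤ frobNorm E * (2 + 2 * x) / g :=
    div_nonneg (mul_nonneg (frobNorm_nonneg _) (by positivity)) hg.le
  have hc : ContractingWith (NNReal.mk (frobNorm E * (2 + 2 * x) / g) hK)
      (hmaps.restrict (riccatiMap γ E) S S) := by
    refine ⟨?_, LipschitzWith.of_dist_le_mul fun P P' => ?_⟩
    · rw [← NNReal.coe_lt_coe]
      exact (div_lt_one hg).2 hcontr
    · rw [Subtype.dist_eq, Subtype.dist_eq, dist_eq_norm, dist_eq_norm, NNReal.coe_mk,
        div_mul_eq_mul_div, le_div_iff₀ hg, mul_comm _ g]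
      exact mul_frobNorm_riccatiMap_sub_le hg hγ E P P' ((hmem _).1 P.2) ((hmem _).1 P'.2)
  have : FiniteDimensional ℝ (Mat s) := inferInstance
  have : CompleteSpace (Mat s) := FiniteDimensional.complete ℝ _
  obtain ⟨P, hP, hfix, -⟩ := hc.exists_fixedPoint' Metric.isClosed_closedBall.isComplete hmaps
    (x := 0) (Metric.mem_closedBall_self hx0) (edist_ne_top _ _)
  exact ⟨P, (hmem P).1 hP, add_mul_one_add_eq_of_isFixedPt hinj hfix⟩

end Riccati

/-! ### Eigenvalues -/

section Complexification

/-- The complexification of a real matrix. -/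
abbrev toC {m n : Type*} (M : Matrix m n ℝ) : Matrix m n ℂ := M.map Complex.ofRealHom

theorem toC_apply {m n : Type*} (M : Matrix m n ℝ) (i : m) (j : n) : toC M i j = (M i j : ℂ) := rfl

theorem norm_sum_sum_mul_sq_le {ι κ : Type*} [Fintype ι] [Fintype κ]
    (S : Matrix ι κ ℝ) (H : ι → κ → ℂ) :
    ‖∑ i, ∑ j, (S i j : ℂ) * H i j‖ ^ 2
      ≤ (∑ i, ∑ j, S i j ^ 2) * ∑ i, ∑ j, ‖H i j‖ ^ 2 := by
  have h1 : ‖∑ i, ∑ j, (S i j : ℂ) * H i j‖ ≤ ∑ p : ι × κ, |S p.1 p.2| * ‖H p.1 p.2‖ := by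
    rw [← Fintype.sum_prod_type']
    refine (norm_sum_le _ _).trans (le_of_eq (Finset.sum_congr rfl fun p _ => ?_))
    rw [norm_mul, Complex.norm_real, Real.norm_eq_abs]
  refine (pow_le_pow_left₀ (norm_nonneg _) h1 2).trans ?_
  refine (Finset.sum_mul_sq_le_sq_mul_sq _ _ _).trans (le_of_eq ?_)
  simp only [sq_abs]
  rw [Fintype.sum_prod_type, Fintype.sum_prod_type]

end Complexification

section Eigenvalues

variable {ι κ : Type*} [Fintype ι] [DecidableEq ι] [Fintype κ] [DecidableEq κ]

theorem pow_mul_eq_mul_pow {A : Matrix ι ι ℂ} {M : Matrix κ κ ℂ} {X : Matrix ι κ ℂ}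
    (h : A * X = X * M) (n : ℕ) : A ^ n * X = X * M ^ n := by
  induction n with
  | zero => simp
  | succ n ih =>
    rw [pow_succ, pow_succ, Matrix.mul_assoc, h, ← Matrix.mul_assoc, ih, Matrix.mul_assoc]

theorem aeval_mul_eq_mul_aeval {A : Matrix ι ι ℂ} {M : Matrix κ κ ℂ} {X : Matrix ι κ ℂ}
    (h : A * X = X * M) (p : Polynomial ℂ) :
    Polynomial.aeval A p * X = X * Polynomial.aeval M p := by
  induction p using Polynomial.induction_on' with
  | add p q hp hq => rw [map_add, map_add, Matrix.add_mul, Matrix.mul_add, hp, hq]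
  | monomial n a =>
    rw [Polynomial.aeval_monomial, Polynomial.aeval_monomial, ← Algebra.smul_def,
      ← Algebra.smul_def, Matrix.smul_mul, Matrix.mul_smul, pow_mul_eq_mul_pow h]

/-- Two matrices that are intertwined by a nonzero matrix share an eigenvalue. -/
theorem exists_common_eigenvalue {A : Matrix ι ι ℂ} {M : Matrix κ κ ℂ} {X : Matrix ι κ ℂ}
    (h : A * X = X * M) (hX : X ≠ 0) :
    ∃ z : ℂ, z ∈ spectrum ℂ A ∧ z ∈ spectrum ℂ M := by
  -- By Cayley–Hamilton the characteristic polynomial of `M`, evaluated at `A`, annihilates `X ≠ 0`.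
  -- It is therefore not invertible, so one of its linear factors `A - z` is not invertible either.
  have h1 : Polynomial.aeval A M.charpoly * X = 0 := by
    rw [aeval_mul_eq_mul_aeval h, Matrix.aeval_self_charpoly, Matrix.mul_zero]
  have h2 : ¬ IsUnit (Polynomial.aeval A M.charpoly) := fun hu => by
    obtain ⟨u, hu⟩ := hu
    apply hX
    have : ((u⁻¹ : (Matrix ι ι ℂ)ˣ) : Matrix ι ι ℂ) * (u : Matrix ι ι ℂ) * X = 0 := by rw [Matrix.mul_assoc, hu, h1, Matrix.mul_zero]
    rwa [Units.inv_mul, Matrix.one_mul] at this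
  have h3 : M.charpoly = (M.charpoly.roots.map fun a => Polynomial.X - Polynomial.C a).prod :=
    (IsAlgClosed.splits M.charpoly).eq_prod_roots_of_monic M.charpoly_monic
  rw [h3] at h2
  obtain ⟨z, hz, hz'⟩ := spectrum.exists_mem_of_not_isUnit_aeval_prod h2
  exact ⟨z, hz, Matrix.mem_spectrum_iff_isRoot_charpoly.2 hz'⟩

theorem det_eq_zero_of_mem_spectrum {A : Matrix ι ι ℂ} {z : ℂ} (h : z ∈ spectrum ℂ A) :
    (A - z • 1).det = 0 := by
  rw [spectrum.mem_iff, Matrix.isUnit_iff_isUnit_det, isUnit_iff_ne_zero, not_not,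
    Algebra.algebraMap_eq_smul_one, ← neg_sub, Matrix.det_neg] at h
  exact (mul_eq_zero.1 h).resolve_left (pow_ne_zero _ (neg_ne_zero.2 one_ne_zero))

theorem exists_eigenvector {A : Matrix ι ι ℂ} {z : ℂ} (h : z ∈ spectrum ℂ A) :
    ∃ u, ∑ i, ‖u i‖ ^ 2 = 1 ∧ A *ᵥ u = z • u := by
  obtain ⟨v, hv, hv'⟩ := Matrix.exists_mulVec_eq_zero_iff.2 (det_eq_zero_of_mem_spectrum h)
  have hv1 : A *ᵥ v = z • v := by
    rwa [Matrix.sub_mulVec, Matrix.smul_mulVec, Matrix.one_mulVec, sub_eq_zero] at hv'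
  have hpos : 0 < ∑ i, ‖v i‖ ^ 2 := by
    obtain ⟨i, hi⟩ := Function.ne_iff.1 hv
    exact Finset.sum_pos' (fun _ _ => by positivity)
      ⟨i, Finset.mem_univ _, by have := norm_pos_iff.2 hi; positivity⟩
  refine ⟨((√(∑ i, ‖v i‖ ^ 2))⁻¹ : ℂ) • v, ?_, ?_⟩
  · simp only [Pi.smul_apply, smul_eq_mul, norm_mul, mul_pow, ← Finset.mul_sum, norm_inv,
      Complex.norm_real, Real.norm_eq_abs, inv_pow, sq_abs]
    rw [Real.sq_sqrt hpos.le, inv_mul_cancel₀ hpos.ne']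
  · rw [Matrix.mulVec_smul, hv1, smul_comm]

/-- Two distinct eigenvalues of `A` are at most `√2` times as far apart as `A` is from the
scalar matrices. -/
theorem norm_sub_sq_le_of_mem_spectrum {A : Matrix ι ι ℝ} {a b : ℂ}
    (ha : a ∈ spectrum ℂ (toC A)) (hb : b ∈ spectrum ℂ (toC A)) (hab : a ≠ b) (z : ℝ) :
    ‖a - b‖ ^ 2 ≤ 2 * ∑ i, ∑ j, (A - z • (1 : Matrix ι ι ℝ)) i j ^ 2 := by
  obtain ⟨u, hu1, hu⟩ := exists_eigenvector ha
  have hb' : b ∈ spectrum ℂ (toC A)ᵀ := by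
    rwa [Matrix.mem_spectrum_iff_isRoot_charpoly, Matrix.charpoly_transpose,
      ← Matrix.mem_spectrum_iff_isRoot_charpoly]
  obtain ⟨v, hv1, hv⟩ := exists_eigenvector hb'
  -- Right and left eigenvectors for different eigenvalues are orthogonal for the bilinear pairing,
  -- that is, `conj u` and `v` are orthogonal for the Hermitian one.
  have horth : ∑ i, u i * v i = 0 := by
    have h1 : v ⬝ᵥ (toC A *ᵥ u) = a * (v ⬝ᵥ u) := by rw [hu, dotProduct_smul, smul_eq_mul]
    have h2 : v ⬝ᵥ (toC A *ᵥ u) = b * (v ⬝ᵥ u) := by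
      rw [Matrix.dotProduct_mulVec, ← Matrix.mulVec_transpose, hv, smul_dotProduct, smul_eq_mul]
    have h3 : (a - b) * (v ⬝ᵥ u) = 0 := by rw [sub_mul, ← h1, ← h2, sub_self]
    have h4 := (mul_eq_zero.1 h3).resolve_left (sub_ne_zero.2 hab)
    simpa [dotProduct, mul_comm] using h4
  have hcu : ∑ i, (starRingEnd ℂ) (u i) * u i = 1 := by
    simp only [Complex.conj_mul', ← Complex.ofReal_pow, ← Complex.ofReal_sum, hu1,
      Complex.ofReal_one]
  have hcv : ∑ i, (starRingEnd ℂ) (v i) * v i = 1 := by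
    simp only [Complex.conj_mul', ← Complex.ofReal_pow, ← Complex.ofReal_sum, hv1,
      Complex.ofReal_one]
  set S := A - z • (1 : Matrix ι ι ℝ) with hS
  have hSC : toC S = toC A - (z : ℂ) • 1 := by
    ext i j
    by_cases hij : i = j <;> simp [hS, hij]
  have hSu : toC S *ᵥ u = (a - z) • u := by
    rw [hSC, Matrix.sub_mulVec, hu, Matrix.smul_mulVec, Matrix.one_mulVec, sub_smul]
  have hSv : (toC S)ᵀ *ᵥ v = (b - z) • v := by
    rw [hSC, Matrix.transpose_sub, Matrix.sub_mulVec, hv, Matrix.transpose_smul,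
      Matrix.transpose_one, Matrix.smul_mulVec, Matrix.one_mulVec, sub_smul]
  -- `H` is the difference of the orthogonal projections onto the lines of `conj u` and `v`. These
  -- lines are orthogonal, so `‖H‖_F² = 2`; pairing `H` with `S` gives `(a - z) - (b - z)`, and
  -- Cauchy–Schwarz yields the factor `2`.
  let H : ι → ι → ℂ := fun i j =>
    (starRingEnd ℂ) (u i) * u j - v i * (starRingEnd ℂ) (v j)
  have h1 : ∑ i, ∑ j, (S i j : ℂ) * ((starRingEnd ℂ) (u i) * u j) = a - z := by
    have : ∀ i, ∑ j, (S i j : ℂ) * ((starRingEnd ℂ) (u i) * u j)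
        = (a - z) * ((starRingEnd ℂ) (u i) * u i) := fun i => by
      have h := congrFun hSu i
      simp only [Matrix.mulVec, dotProduct, Pi.smul_apply, smul_eq_mul, Matrix.map_apply,
        Complex.ofRealHom_eq_coe] at h
      rw [mul_left_comm, ← h, Finset.mul_sum]
      exact Finset.sum_congr rfl fun j _ => by ring
    simp only [this, ← Finset.mul_sum, hcu, mul_one]
  have h2 : ∑ i, ∑ j, (S i j : ℂ) * (v i * (starRingEnd ℂ) (v j)) = b - z := by
    rw [Finset.sum_comm]
    have : ∀ j, ∑ i, (S i j : ℂ) * (v i * (starRingEnd ℂ) (v j))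
        = (b - z) * ((starRingEnd ℂ) (v j) * v j) := fun j => by
      have h := congrFun hSv j
      simp only [Matrix.mulVec, dotProduct, Pi.smul_apply, smul_eq_mul, Matrix.map_apply,
        Complex.ofRealHom_eq_coe, Matrix.transpose_apply] at h
      rw [mul_left_comm, ← h, Finset.mul_sum]
      exact Finset.sum_congr rfl fun j _ => by ring
    simp only [this, ← Finset.mul_sum, hcv, mul_one]
  have h3 : ∑ i, ∑ j, (S i j : ℂ) * H i j = a - b := by
    simp only [H, mul_sub, Finset.sum_sub_distrib, h1, h2]
    ring
  have h4 : ∑ i, ∑ j, ‖H i j‖ ^ 2 = 2 := by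
    have hH : ∀ i j, ((‖H i j‖ ^ 2 : ℝ) : ℂ)
        = (starRingEnd ℂ) (u i) * u i * ((starRingEnd ℂ) (u j) * u j)
          - (starRingEnd ℂ) (u i * v i) * (u j * v j)
          - (u i * v i) * (starRingEnd ℂ) (u j * v j)
          + (starRingEnd ℂ) (v i) * v i * ((starRingEnd ℂ) (v j) * v j) := fun i j => by
      rw [Complex.ofReal_pow, ← Complex.conj_mul']
      simp only [H, map_sub, map_mul, Complex.conj_conj]
      ring
    have : ((∑ i, ∑ j, ‖H i j‖ ^ 2 : ℝ) : ℂ) = 2 := by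
      simp only [Complex.ofReal_sum, hH, Finset.sum_add_distrib, Finset.sum_sub_distrib,
        ← Finset.mul_sum, ← Finset.sum_mul, ← map_sum, horth, hcu, hcv]
      norm_num
    exact_mod_cast this
  have h5 := norm_sum_sum_mul_sq_le S H
  rw [h3, h4, mul_comm] at h5
  exact h5

theorem sum_norm_sq_toC_mulVec_le (M : Matrix ι ι ℝ) (w : ι → ℂ) :
    ∑ i, ‖(toC M *ᵥ w) i‖ ^ 2 ≤ frobNorm M ^ 2 * ∑ i, ‖w i‖ ^ 2 := by
  rw [frobNorm_sq, Finset.sum_mul]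
  refine Finset.sum_le_sum fun i _ => ?_
  have h1 : ‖(toC M *ᵥ w) i‖ ≤ ∑ j, |M i j| * ‖w j‖ := by
    refine (norm_sum_le _ _).trans (le_of_eq (Finset.sum_congr rfl fun j _ => ?_))
    simp
  refine (pow_le_pow_left₀ (norm_nonneg _) h1 2).trans ?_
  refine (Finset.sum_mul_sq_le_sq_mul_sq _ _ _).trans (le_of_eq ?_)
  simp only [sq_abs]

end Eigenvalues

/-! ### Spectra of the diagonal blocks -/

section Separation

open scoped Matrix.Norms.Frobenius

variable {t : ℕ} {s : Fin t → ℕ}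

theorem mulVec_extend (M : Matrix (Idx s) (Idx s) ℂ) (k : Fin t) (y : Fin (s k) → ℂ) (x : Idx s) :
    (M *ᵥ Function.extend (fun b => (⟨k, b⟩ : Idx s)) y 0) x = ∑ b, M x ⟨k, b⟩ * y b := by
  have hinj : Function.Injective fun b => (⟨k, b⟩ : Idx s) :=
    fun _ _ hab => eq_of_heq (Sigma.mk.inj hab).2
  rw [Matrix.mulVec, dotProduct, Fintype.sum_sigma, Finset.sum_eq_single k]
  · exact Finset.sum_congr rfl fun b _ => by rw [hinj.extend_apply]
  · intro j _ hj
    refine Finset.sum_eq_zero fun b _ => ?_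
    rw [Function.extend_apply', Pi.zero_apply, mul_zero]
    rintro ⟨c, hc⟩
    exact hj (congrArg Sigma.fst hc).symm
  · simp

/-- An eigenvector of the `k`-th block, extended by zero and multiplied by `1 + P`, is an
eigenvector `v` of `Γ + E`, so `(E v)_x = (z - γ_x) v_x`. A first bound `‖z - γ_k‖ ≤ g / 2` makes
`γ_k` a nearest point to `z` among all the `γ_j`; the eigenvector equation then improves it to
`‖E‖_F`, without the factor `1 + x`. -/
theorem norm_sub_le_of_mem_spectrum_blk {γ : Fin t → ℝ} {g : ℝ}
    (hγ : ∀ j k, j ≠ k → g ≤ |γ j - γ k|) {E P : Mat s} {x : ℝ} (hP : frobNorm P ≤ x)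
    (hsmall : frobNorm E * (1 + x) ≤ g / 2) (hP0 : bdiag P = 0)
    (h : (gammaMat s γ + E) * (1 + P) = (1 + P) * (gammaMat s γ + bdiag (E * (1 + P))))
    {k : Fin t} {z : ℂ}
    (hz : z ∈ spectrum ℂ (toC (Matrix.blockDiag' (gammaMat s γ + bdiag (E * (1 + P))) k))) :
    ‖z - γ k‖ ≤ frobNorm E := by
  set B := bdiag (E * (1 + P)) with hB
  obtain ⟨y, hy1, hy⟩ := exists_eigenvector hz
  have hinj : Function.Injective fun b => (⟨k, b⟩ : Idx s) :=
    fun _ _ hab => eq_of_heq (Sigma.mk.inj hab).2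
  set Y : Idx s → ℂ := Function.extend (fun b => (⟨k, b⟩ : Idx s)) y 0 with hY
  have hYk : ∀ b, Y ⟨k, b⟩ = y b := fun b => hinj.extend_apply _ _ _
  have hYn : ∀ x : Idx s, x.1 ≠ k → Y x = 0 := fun x hx => by
    rw [hY, Function.extend_apply', Pi.zero_apply]
    rintro ⟨c, hc⟩
    exact hx (congrArg Sigma.fst hc).symm
  have hYsum : ∑ x, ‖Y x‖ ^ 2 = 1 := by
    rw [Fintype.sum_sigma, Finset.sum_eq_single k]
    · simp only [hYk, hy1]
    · exact fun j _ hj => Finset.sum_eq_zero fun b _ => by simp [hYn ⟨j, b⟩ hj]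
    · simp
  have hBd : B ∈ blockDiagSet s := bdiag_mem _
  have hΓd : gammaMat s γ ∈ blockDiagSet s := mem_blockDiagSet_iff.2 fun x y hxy =>
    Matrix.diagonal_apply_ne _ fun h' => hxy (congrArg Sigma.fst h')
  have hΓw : ∀ w : Idx s → ℂ, toC (gammaMat s γ) *ᵥ w = fun x => (γ x.1 : ℂ) * w x := fun w => by
    ext x
    rw [gammaMat, toC, Matrix.diagonal_map (map_zero _), Matrix.mulVec_diagonal]
    rfl
  have heig : toC (gammaMat s γ + B) *ᵥ Y = z • Y := by
    ext x
    rw [hY, mulVec_extend]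
    obtain ⟨j, a⟩ := x
    by_cases hj : j = k
    · subst hj
      have := congrFun hy a
      rw [Pi.smul_apply, ← hY, hYk]
      exact this
    · rw [Pi.smul_apply, ← hY, hYn ⟨j, a⟩ hj, smul_zero]
      refine Finset.sum_eq_zero fun b _ => ?_
      rw [toC_apply, Matrix.add_apply, mem_blockDiagSet_iff.1 hBd _ _ hj,
        mem_blockDiagSet_iff.1 hΓd _ _ hj, add_zero, Complex.ofReal_zero, zero_mul]
  have hcrude : ‖z - γ k‖ ≤ g / 2 := by
    have hBY : toC B *ᵥ Y = (z - γ k) • Y := by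
      rw [toC, Matrix.map_add _ (map_add _), Matrix.add_mulVec, hΓw] at heig
      rw [sub_smul, ← heig]
      ext x
      rw [Pi.sub_apply, Pi.add_apply, Pi.smul_apply, smul_eq_mul]
      by_cases hx : x.1 = k
      · rw [hx]; ring
      · rw [hYn x hx]; ring
    have h1 := sum_norm_sq_toC_mulVec_le B Y
    rw [hBY] at h1
    simp only [Pi.smul_apply, norm_smul, mul_pow, ← Finset.mul_sum, hYsum, mul_one] at h1
    refine (le_of_sq_le_sq h1 (frobNorm_nonneg _)).trans (le_trans ?_ hsmall)
    refine (frobNorm_bdiag_le _).trans ((frobNorm_mul_one_add_le _ _).trans ?_)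
    exact mul_le_mul_of_nonneg_left (by linarith) (frobNorm_nonneg _)
  set v := toC (1 + P) *ᵥ Y with hv
  have hvk : ∀ b, v ⟨k, b⟩ = y b := fun b => by
    rw [hv, toC, Matrix.map_add _ (map_add _), Matrix.add_mulVec,
      Matrix.map_one _ (map_zero _) (map_one _), Matrix.one_mulVec, Pi.add_apply, hYk, hY,
      mulVec_extend, Finset.sum_eq_zero, add_zero]
    intro c _
    have := congrFun (congrFun hP0 ⟨k, b⟩) ⟨k, c⟩
    rw [bdiag_apply, if_pos rfl] at this
    change ((P ⟨k, b⟩ ⟨k, c⟩ : ℝ) : ℂ) * y c = 0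
    rw [this]
    simp
  -- Since `P` has zero diagonal blocks, the `k`-th component of `v` is still `y`, so `v` cannot
  -- vanish.
  have hvpos : 0 < ∑ x, ‖v x‖ ^ 2 := by
    refine lt_of_lt_of_le zero_lt_one ?_
    rw [← hy1, Fintype.sum_sigma]
    simp only [← hvk]
    exact Finset.single_le_sum (f := fun j => ∑ b, ‖v ⟨j, b⟩‖ ^ 2) (fun j _ => by positivity)
      (Finset.mem_univ k)
  have hEv : toC E *ᵥ v = fun x => (z - γ x.1) * v x := by
    have h1 : toC (gammaMat s γ + E) *ᵥ v = z • v := by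
      rw [hv, Matrix.mulVec_mulVec, ← Matrix.map_mul, h, Matrix.map_mul, ← Matrix.mulVec_mulVec,
        heig, Matrix.mulVec_smul]
    rw [toC, Matrix.map_add _ (map_add _), Matrix.add_mulVec, hΓw] at h1
    ext x
    have := congrFun h1 x
    rw [Pi.add_apply, Pi.smul_apply, smul_eq_mul] at this
    linear_combination this
  have hfar : ∀ j, ‖z - γ k‖ ≤ ‖z - γ j‖ := fun j => by
    by_cases hj : j = k
    · rw [hj]
    · have h1 := hγ j k hj
      have h2 : |γ j - γ k| ≤ ‖z - γ k‖ + ‖z - γ j‖ := by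
        rw [← Real.norm_eq_abs, ← Complex.norm_real]
        have : ((γ j - γ k : ℝ) : ℂ) = (z - γ k) - (z - γ j) := by push_cast; ring
        rw [this]
        exact norm_sub_le _ _
      linarith
  have h2 := sum_norm_sq_toC_mulVec_le E v
  rw [hEv] at h2
  have h3 : ‖z - γ k‖ ^ 2 * ∑ x, ‖v x‖ ^ 2 ≤ frobNorm E ^ 2 * ∑ x, ‖v x‖ ^ 2 := by
    refine le_trans ?_ h2
    rw [Finset.mul_sum]
    refine Finset.sum_le_sum fun x _ => ?_
    rw [norm_mul, mul_pow]
    exact mul_le_mul_of_nonneg_right (pow_le_pow_left₀ (norm_nonneg _) (hfar _) 2) (sq_nonneg _)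
  exact le_of_sq_le_sq (le_of_mul_le_mul_right h3 hvpos) (frobNorm_nonneg _)

/-- A row of blocks of an intertwining matrix has at most one nonzero block. -/
theorem eq_of_blk_ne_zero {γ : Fin t → ℝ} {g : ℝ}
    (hγ : ∀ j k, j ≠ k → g ≤ |γ j - γ k|) {E P : Mat s} {x : ℝ} (hP : frobNorm P ≤ x)
    (hsmall : frobNorm E * (1 + x) ≤ g / 2) (hP0 : bdiag P = 0)
    (h : (gammaMat s γ + E) * (1 + P) = (1 + P) * (gammaMat s γ + bdiag (E * (1 + P))))
    {Z X : Mat s} (hX : bdiag Z * X = X * (gammaMat s γ + bdiag (E * (1 + P))))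
    {j : Fin t} {z : ℝ}
    (hz : √2 * ‖blk Z j j - z • (1 : Matrix (Fin (s j)) (Fin (s j)) ℝ)‖ + 2 * frobNorm E < g)
    {k l : Fin t} (hk : blk X j k ≠ 0) (hl : blk X j l ≠ 0) : k = l := by
  by_contra hkl
  have hΓB : gammaMat s γ + bdiag (E * (1 + P)) ∈ blockDiagSet s :=
    mem_blockDiagSet_iff.2 fun x y hxy => by
      rw [Matrix.add_apply, mem_blockDiagSet_iff.1 (bdiag_mem _) x y hxy, add_zero]
      exact Matrix.diagonal_apply_ne _ fun h' => hxy (congrArg Sigma.fst h')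
  -- A nonzero block `X_jk` intertwines `Z_jj` with the `k`-th diagonal block on the right, so the
  -- two share an eigenvalue.
  have key : ∀ k, blk X j k ≠ 0 → ∃ a : ℂ, a ∈ spectrum ℂ (toC (blk Z j j)) ∧
      ‖a - γ k‖ ≤ frobNorm E := fun k hk => by
    have h1 := congrArg (fun M => blk M j k) hX
    simp only [blk_mul_of_mem (bdiag_mem Z), blk_mul_of_mem_right hΓB] at h1
    have h2 : Matrix.blockDiag' (bdiag Z) j = blk Z j j := by
      ext a b
      rw [Matrix.blockDiag'_apply, bdiag_apply, if_pos rfl, blk_apply]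
    rw [h2] at h1
    have h3 := congrArg toC h1
    simp only [toC, Matrix.map_mul] at h3
    obtain ⟨a, ha, ha'⟩ := exists_common_eigenvalue h3 fun h0 => hk <| by
      ext b c
      have := congrFun (congrFun h0 b) c
      simpa using this
    exact ⟨a, ha, norm_sub_le_of_mem_spectrum_blk hγ hP hsmall hP0 h ha'⟩
  obtain ⟨a, ha, ha'⟩ := key k hk
  obtain ⟨b, hb, hb'⟩ := key l hl
  have h1 := hγ k l hkl
  have h2 : |γ k - γ l| ≤ frobNorm E + ‖a - b‖ + frobNorm E := by
    rw [← Real.norm_eq_abs, ← Complex.norm_real]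
    have : ((γ k - γ l : ℝ) : ℂ) = -(a - γ k) + (a - b) + (b - γ l) := by push_cast; ring
    rw [this]
    refine (norm_add_le _ _).trans (add_le_add ((norm_add_le _ _).trans (add_le_add ?_ le_rfl)) hb')
    rwa [norm_neg]
  have hne : a ≠ b := by
    rintro rfl
    rw [sub_self, norm_zero] at h2
    have := norm_nonneg (blk Z j j - z • (1 : Matrix (Fin (s j)) (Fin (s j)) ℝ))
    have : 0 ≤ √2 * ‖blk Z j j - z • (1 : Matrix (Fin (s j)) (Fin (s j)) ℝ)‖ := by positivity
    linarith
  have h3 := norm_sub_sq_le_of_mem_spectrum ha hb hne z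
  have h4 := frobenius_norm_sq (blk Z j j - z • (1 : Matrix (Fin (s j)) (Fin (s j)) ℝ))
  simp only [Real.norm_eq_abs, sq_abs] at h4
  rw [← h4] at h3
  have h5 : ‖a - b‖ ≤ √2 * ‖blk Z j j - z • (1 : Matrix (Fin (s j)) (Fin (s j)) ℝ)‖ := by
    refine le_of_sq_le_sq ?_ (by positivity)
    rwa [mul_pow, Real.sq_sqrt (by norm_num)]
  linarith

end Separation

/-! ### Matrices with one nonzero block in each block row -/

section Structure

variable {t : ℕ} {s : Fin t → ℕ}

/-- Invertibility gives every block row a nonzero block, at `f j`, and makes `f` surjective, hence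
bijective. The rows in block `j` are independent and supported in block `f j`, so `s j ≤ s (f j)`;
both sides have the same sum over `j`, which forces equality throughout. -/
theorem exists_perm_of_blk_subsingleton (hs : ∀ j, 0 < s j) {X : Mat s} (hX : IsUnit X)
    (h : ∀ j k l, blk X j k ≠ 0 → blk X j l ≠ 0 → k = l) :
    ∃ π : Equiv.Perm (Fin t), (∀ j, s (π j) = s j) ∧ ∀ x y : Idx s, y.1 ≠ π x.1 → X x y = 0 := by
  have hdet : X.det ≠ 0 := ((Matrix.isUnit_iff_isUnit_det _).1 hX).ne_zero
  have hblk : ∀ x y : Idx s, X x y ≠ 0 → blk X x.1 y.1 ≠ 0 := fun x y hxy h0 =>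
    hxy (congrFun (congrFun h0 x.2) y.2)
  have hrow : ∀ j, ∃ k, blk X j k ≠ 0 := fun j => by
    by_contra! h0
    refine hdet (Matrix.det_eq_zero_of_row_eq_zero ⟨j, ⟨0, hs j⟩⟩ fun y => ?_)
    exact congrFun (congrFun (h0 y.1) ⟨0, hs j⟩) y.2
  choose f hf using hrow
  have hzero : ∀ x y : Idx s, y.1 ≠ f x.1 → X x y = 0 := fun x y hxy => by
    by_contra h0
    exact hxy (h _ _ _ (hblk x y h0) (hf _))
  have hsurj : Function.Surjective f := fun k => by
    by_contra! h0
    refine hdet (Matrix.det_eq_zero_of_column_eq_zero ⟨k, ⟨0, hs k⟩⟩ fun x => ?_)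
    exact hzero _ _ (h0 x.1).symm
  have hle : ∀ j, s j ≤ s (f j) := fun j => by
    have hinj : Function.Injective (Matrix.vecMulLinear (blk X j (f j))) := by
      rw [← LinearMap.ker_eq_bot, LinearMap.ker_eq_bot']
      intro v hv
      have hinj' : Function.Injective fun b => (⟨j, b⟩ : Idx s) :=
    fun _ _ hab => eq_of_heq (Sigma.mk.inj hab).2
      have h1 : Function.extend (fun b => (⟨j, b⟩ : Idx s)) v 0 ᵥ* X = 0 := by
        ext y
        rw [Matrix.vecMul, dotProduct, Fintype.sum_sigma, Finset.sum_eq_single j]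
        · simp only [hinj'.extend_apply]
          obtain ⟨k, b⟩ := y
          by_cases hk : k = f j
          · subst hk
            exact congrFun hv b
          · exact Finset.sum_eq_zero fun a _ => by rw [hzero ⟨j, a⟩ ⟨k, b⟩ hk, mul_zero]
        · intro l _ hl
          refine Finset.sum_eq_zero fun b _ => ?_
          rw [Function.extend_apply', Pi.zero_apply, zero_mul]
          rintro ⟨c, hc⟩
          exact hl (congrArg Sigma.fst hc).symm
        · simp
      have h2 := Matrix.eq_zero_of_vecMul_eq_zero hdet h1
      ext b
      rw [← hinj'.extend_apply v 0 b, h2]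
      rfl
    simpa using LinearMap.finrank_le_finrank_of_injective hinj
  have hbij : Function.Bijective f := Finite.surjective_iff_bijective.1 hsurj
  refine ⟨Equiv.ofBijective f hbij, ?_, hzero⟩
  have hsum : ∑ j, s j = ∑ j, s (f j) :=
    (Equiv.sum_comp (Equiv.ofBijective f hbij) s).symm
  have := (Finset.sum_eq_sum_iff_of_le fun j _ => hle j).1 hsum
  exact fun j => (this j (Finset.mem_univ j)).symm

/-- A permutation of equally sized blocks lifts to a permutation of the indices. -/
theorem exists_perm_fst {π : Equiv.Perm (Fin t)} (h : ∀ j, s (π j) = s j) :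
    ∃ σ : Equiv.Perm (Idx s), ∀ x, π (σ x).1 = x.1 := by
  have h' : ∀ j, s j = s (π.symm j) := fun j => by
    conv_lhs => rw [← π.apply_symm_apply j]
    exact h _
  exact ⟨Equiv.sigmaCongr π.symm fun j => finCongr (h' j), fun x => π.apply_symm_apply x.1⟩

end Structure

/-! ### Orthogonal polar factors of block diagonal matrices -/

section Polar

theorem exists_orthogonal_diagonalization {ι : Type*} [Fintype ι] [DecidableEq ι]
    {S : Matrix ι ι ℝ} (hS : Sᵀ = S) :
    ∃ (V : Matrix ι ι ℝ) (d : ι → ℝ), Vᵀ * V = 1 ∧ V * Vᵀ = 1 ∧ S = V * Matrix.diagonal d * Vᵀ := by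
  have hH : S.IsHermitian := by
    rw [Matrix.IsHermitian, Matrix.conjTranspose_eq_transpose_of_trivial, hS]
  have hV := (Matrix.mem_unitaryGroup_iff'.1 hH.eigenvectorUnitary.2)
  rw [Matrix.star_eq_conjTranspose, Matrix.conjTranspose_eq_transpose_of_trivial] at hV
  refine ⟨hH.eigenvectorUnitary, hH.eigenvalues, hV, mul_eq_one_comm.1 hV, ?_⟩
  have h := hH.spectral_theorem
  rw [Unitary.conjStarAlgAut_apply, Matrix.star_eq_conjTranspose,
    Matrix.conjTranspose_eq_transpose_of_trivial] at h
  exact h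

/-- The hypothesis on `e` says that it is a function of `d`: a matrix commuting with `diagonal d`
has nonzero entries only where `d i = d j`. -/
theorem mul_diagonal_comm_of_mul_diagonal_comm {ι : Type*} [Fintype ι] [DecidableEq ι]
    {d e : ι → ℝ} (he : ∀ i j, d i = d j → e i = e j) {M : Matrix ι ι ℝ}
    (h : M * Matrix.diagonal d = Matrix.diagonal d * M) :
    M * Matrix.diagonal e = Matrix.diagonal e * M := by
  ext i j
  have h1 := congrFun (congrFun h i) j
  rw [Matrix.mul_diagonal, Matrix.diagonal_mul] at h1 ⊢
  by_cases hij : d i = d j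
  · rw [he i j hij, mul_comm]
  · have : M i j * (d j - d i) = 0 := by linear_combination h1
    rw [(mul_eq_zero.1 this).resolve_right (sub_ne_zero.2 (Ne.symm hij)), zero_mul, mul_zero]

variable {t : ℕ} {s : Fin t → ℕ}

theorem mem_blockDiagSet_iff_commute {γ : Fin t → ℝ} (hγ : Function.Injective γ) {M : Mat s} :
    M ∈ blockDiagSet s ↔ M * gammaMat s γ = gammaMat s γ * M := by
  rw [mem_blockDiagSet_iff]
  constructor
  · intro h
    ext x y
    rw [gammaMat, Matrix.mul_diagonal, Matrix.diagonal_mul]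
    by_cases hxy : x.1 = y.1
    · rw [hxy, mul_comm]
    · rw [h x y hxy, zero_mul, mul_zero]
  · intro h x y hxy
    have h1 := congrFun (congrFun h x) y
    rw [gammaMat, Matrix.mul_diagonal, Matrix.diagonal_mul] at h1
    have : M x y * (γ y.1 - γ x.1) = 0 := by linear_combination h1
    exact (mul_eq_zero.1 this).resolve_right (sub_ne_zero.2 fun h' => hxy (hγ h').symm)

/-- Functional calculus preserves block diagonality. Being block diagonal means commuting with a
diagonal matrix `G` that has distinct labels on the blocks; the labels `0, …, t - 1` serve here.
After conjugation by `V` this is a commutation with `diagonal d`, which passes to functions of `d`.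
-/
theorem conj_diagonal_mem_blockDiagSet {V : Mat s} (hV : Vᵀ * V = 1) (hV' : V * Vᵀ = 1)
    {d e : Idx s → ℝ} (he : ∀ i j, d i = d j → e i = e j)
    (h : V * Matrix.diagonal d * Vᵀ ∈ blockDiagSet s) :
    V * Matrix.diagonal e * Vᵀ ∈ blockDiagSet s := by
  have hγ : Function.Injective fun j : Fin t => ((j : ℕ) : ℝ) := fun a b hab => by
    simpa [Fin.ext_iff] using hab
  rw [mem_blockDiagSet_iff_commute hγ] at h ⊢
  set G := gammaMat s fun j : Fin t => ((j : ℕ) : ℝ)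
  have hconj : ∀ f : Idx s → ℝ, V * Matrix.diagonal f * Vᵀ * G = G * (V * Matrix.diagonal f * Vᵀ) ↔
      (Vᵀ * G * V) * Matrix.diagonal f = Matrix.diagonal f * (Vᵀ * G * V) := fun f => by
    constructor
    · intro hf
      calc (Vᵀ * G * V) * Matrix.diagonal f
          = Vᵀ * (G * (V * Matrix.diagonal f * Vᵀ)) * V := by
            simp only [Matrix.mul_assoc]
            rw [hV, Matrix.mul_one]
        _ = (Vᵀ * V) * Matrix.diagonal f * Vᵀ * G * V := by
            rw [← hf]; simp only [Matrix.mul_assoc]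
        _ = _ := by rw [hV, Matrix.one_mul]; simp only [Matrix.mul_assoc]
    · intro hf
      calc V * Matrix.diagonal f * Vᵀ * G
          = V * (Matrix.diagonal f * (Vᵀ * G * V)) * Vᵀ := by
            simp only [Matrix.mul_assoc]
            rw [hV', Matrix.mul_one]
        _ = (V * Vᵀ) * G * V * Matrix.diagonal f * Vᵀ := by
            rw [← hf]; simp only [Matrix.mul_assoc]
        _ = _ := by rw [hV', Matrix.one_mul]; simp only [Matrix.mul_assoc]
  rw [hconj] at h ⊢
  exact mul_diagonal_comm_of_mul_diagonal_comm he h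

theorem specNorm_conj_diagonal_le {ι : Type*} [Fintype ι] [DecidableEq ι] {V : Matrix ι ι ℝ}
    (hV : Vᵀ * V = 1) {d : ι → ℝ} {c : ℝ} (hc : 0 ≤ c) (h : ∀ i, |d i| ≤ c) :
    specNorm (V * Matrix.diagonal d * Vᵀ) ≤ c := by
  have hV1 := specNorm_le_one_of_orthogonal hV
  have hd := specNorm_diagonal_le d hc h
  refine (specNorm_mul_le _ _).trans ?_
  rw [specNorm_transpose]
  refine (mul_le_of_le_one_right (specNorm_nonneg _) hV1).trans ((specNorm_mul_le _ _).trans ?_)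
  exact (mul_le_of_le_one_left (specNorm_nonneg _) hV1).trans hd

/-- The inverse of the symmetric polar factor of a nearly orthogonal block diagonal matrix. -/
theorem exists_inverse_polar_factor {D : Mat s} (hD : D ∈ blockDiagSet s) {a : ℝ} (ha0 : 0 ≤ a)
    (ha1 : a < 1) (hlow : ∀ v : Idx s → ℝ, (1 - a) ^ 2 * ∑ i, v i ^ 2 ≤ ∑ i, (D *ᵥ v) i ^ 2)
    (hup : ∀ v : Idx s → ℝ, ∑ i, (D *ᵥ v) i ^ 2 ≤ (1 + a) ^ 2 * ∑ i, v i ^ 2) :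
    ∃ K ∈ blockDiagSet s, (D * K)ᵀ * (D * K) = 1 ∧ specNorm K ≤ 1 / (1 - a) ∧
      specNorm (K - 1) ≤ 1 / (1 - a) - 1 := by
  obtain ⟨V, d, hV, hV', hS⟩ := exists_orthogonal_diagonalization (S := Dᵀ * D)
    (by rw [Matrix.transpose_mul, Matrix.transpose_transpose])
  have hdiag : Vᵀ * (Dᵀ * D) * V = Matrix.diagonal d := by
    rw [hS]
    calc _ = (Vᵀ * V) * Matrix.diagonal d * (Vᵀ * V) := by simp only [Matrix.mul_assoc]
      _ = _ := by rw [hV, Matrix.one_mul, Matrix.mul_one]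
  have hcol : ∀ i, ∑ j, V j i ^ 2 = 1 := fun i => by
    have := congrFun (congrFun hV i) i
    rw [Matrix.mul_apply, Matrix.one_apply_eq] at this
    simpa [sq] using this
  have hd : ∀ i, d i = ∑ j, (D *ᵥ fun k => V k i) j ^ 2 := fun i => by
    have h1 := congrFun (congrFun hdiag i) i
    rw [Matrix.diagonal_apply_eq, ← Matrix.mul_assoc, ← Matrix.transpose_mul, Matrix.mul_assoc,
      Matrix.mul_apply] at h1
    rw [← h1]
    refine Finset.sum_congr rfl fun j _ => ?_
    rw [sq]
    rfl
  have h1a : 0 < 1 - a := sub_pos.2 ha1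
  have hdlow : ∀ i, (1 - a) ^ 2 ≤ d i := fun i => by
    have := hlow fun k => V k i
    rwa [hcol, mul_one, ← hd] at this
  have hdup : ∀ i, d i ≤ (1 + a) ^ 2 := fun i => by
    have := hup fun k => V k i
    rwa [hcol, mul_one, ← hd] at this
  have hdpos : ∀ i, 0 < d i := fun i => lt_of_lt_of_le (by positivity) (hdlow i)
  have hsl : ∀ i, 1 - a ≤ √(d i) := fun i => Real.le_sqrt_of_sq_le (hdlow i)
  have hsu : ∀ i, √(d i) ≤ 1 + a := fun i => by
    rw [← Real.sqrt_sq (show 0 ≤ 1 + a by linarith)]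
    exact Real.sqrt_le_sqrt (hdup i)
  -- This choice makes the witness `V * diagonal e * Vᵀ` equal to `(Dᵀ D)^(-1/2)`.
  set e : Idx s → ℝ := fun i => 1 / √(d i) with he
  have hbd : V * Matrix.diagonal d * Vᵀ ∈ blockDiagSet s :=
    hS ▸ blockDiagSet_mul (blockDiagSet_transpose hD) hD
  have hele : ∀ i, e i ≤ 1 / (1 - a) := fun i => one_div_le_one_div_of_le h1a (hsl i)
  have hepos : ∀ i, 0 < e i := fun i => one_div_pos.2 (Real.sqrt_pos.2 (hdpos i))
  have hKt : (V * Matrix.diagonal e * Vᵀ)ᵀ = V * Matrix.diagonal e * Vᵀ := by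
    rw [Matrix.transpose_mul, Matrix.transpose_mul, Matrix.transpose_transpose,
      Matrix.diagonal_transpose, Matrix.mul_assoc]
  refine ⟨V * Matrix.diagonal e * Vᵀ,
    conj_diagonal_mem_blockDiagSet hV hV' (fun i j hij => by simp only [he, hij]) hbd, ?_, ?_, ?_⟩
  · rw [Matrix.transpose_mul, hKt]
    calc V * Matrix.diagonal e * Vᵀ * Dᵀ * (D * (V * Matrix.diagonal e * Vᵀ))
        = V * (Matrix.diagonal e * (Vᵀ * (Dᵀ * D) * V) * Matrix.diagonal e) * Vᵀ := by
          simp only [Matrix.mul_assoc]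
      _ = V * Vᵀ := by
          rw [hdiag, Matrix.diagonal_mul_diagonal, Matrix.diagonal_mul_diagonal]
          have : (fun i => e i * d i * e i) = fun _ => 1 := by
            ext i
            have hne : √(d i) ≠ 0 := (Real.sqrt_pos.2 (hdpos i)).ne'
            have hsq := Real.mul_self_sqrt (hdpos i).le
            simp only [he]
            field_simp
            rw [sq, hsq]
          rw [this, Matrix.diagonal_one, Matrix.mul_one]
      _ = 1 := hV'
  · exact specNorm_conj_diagonal_le hV (by positivity) fun i => by
      rw [abs_of_pos (hepos i)]
      exact hele i
  · have h1 : V * Matrix.diagonal e * Vᵀ - 1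
        = V * Matrix.diagonal (fun i => e i - 1) * Vᵀ := by
      have : Matrix.diagonal (fun i => e i - 1) = Matrix.diagonal e - 1 := by
        rw [← Matrix.diagonal_one, Matrix.diagonal_sub]
      rw [this, Matrix.mul_sub, Matrix.sub_mul, Matrix.mul_one, hV']
    have h2 : 1 ≤ 1 / (1 - a) := by
      rw [le_div_iff₀ h1a]
      linarith
    rw [h1]
    refine specNorm_conj_diagonal_le hV (by linarith) fun i => abs_le.2 ⟨?_, ?_⟩
    · have h3 : 1 / (1 + a) ≤ e i :=
        one_div_le_one_div_of_le (Real.sqrt_pos.2 (hdpos i)) (hsu i)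
      -- Convexity of the reciprocal: the deviation of `e i` below `1` is no larger than the allowed
      -- deviation above `1`.
      have h4 : 2 ≤ 1 / (1 - a) + 1 / (1 + a) := by
        rw [div_add_div _ _ h1a.ne' (by linarith), le_div_iff₀ (by nlinarith)]
        nlinarith [sq_nonneg a]
      linarith
    · linarith [hele i]

end Polar

/-! ### Block components of vectors -/

section Parts

variable {t : ℕ} {s : Fin t → ℕ}

/-- The component of a vector in the `j`-th block. -/
def part (j : Fin t) (v : Idx s → ℝ) : Idx s → ℝ := fun x => if x.1 = j then v x else 0

theorem sum_part (v : Idx s → ℝ) : ∑ j, part j v = v := by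
  ext x
  simp [part]

theorem part_dotProduct_mulVec_part (M : Mat s) (j : Fin t) (v : Idx s → ℝ) :
    part j v ⬝ᵥ (M *ᵥ part j v) = part j v ⬝ᵥ (bdiag M *ᵥ part j v) := by
  simp only [dotProduct]
  refine Finset.sum_congr rfl fun x _ => ?_
  by_cases hx : x.1 = j
  · congr 1
    simp only [Matrix.mulVec, dotProduct]
    refine Finset.sum_congr rfl fun y _ => ?_
    rw [bdiag_apply]
    by_cases hy : y.1 = j
    · rw [if_pos (hx.trans hy.symm)]
    · simp [part, hy]
  · simp [part, hx]

theorem dotProduct_bdiag_mulVec (M : Mat s) (v : Idx s → ℝ) :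
    v ⬝ᵥ (bdiag M *ᵥ v) = ∑ j, part j v ⬝ᵥ (M *ᵥ part j v) := by
  rw [Finset.sum_congr rfl fun j _ => part_dotProduct_mulVec_part M j v]
  simp only [dotProduct]
  rw [Finset.sum_comm]
  refine Finset.sum_congr rfl fun x _ => ?_
  rw [Finset.sum_eq_single x.1]
  · simp only [part, if_true]
    congr 1
    simp only [Matrix.mulVec, dotProduct]
    refine Finset.sum_congr rfl fun y _ => ?_
    rw [bdiag_apply]
    by_cases hy : x.1 = y.1
    · rw [part, if_pos hy.symm]
    · simp [hy]
  · intro j _ hj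
    simp [part, hj.symm]
  · simp

/-- The Euclidean norm of a coordinate vector. -/
def l2 (v : Idx s → ℝ) : ℝ := ‖WithLp.toLp 2 v‖

theorem l2_nonneg (v : Idx s → ℝ) : 0 ≤ l2 v := norm_nonneg _

theorem l2_sq (v : Idx s → ℝ) : l2 v ^ 2 = ∑ x, v x ^ 2 := by
  rw [l2, EuclideanSpace.norm_sq_eq]
  simp

theorem l2_sq_eq_dotProduct (v : Idx s → ℝ) : l2 v ^ 2 = v ⬝ᵥ v := by
  rw [l2_sq]
  simp [dotProduct, sq]

theorem l2_mulVec_sq (M : Mat s) (v : Idx s → ℝ) : l2 (M *ᵥ v) ^ 2 = v ⬝ᵥ ((Mᵀ * M) *ᵥ v) := by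
  rw [l2_sq_eq_dotProduct, Matrix.dotProduct_mulVec, ← Matrix.mulVec_transpose,
    Matrix.mulVec_mulVec, dotProduct_comm]

theorem l2_sq_eq_sum_part (v : Idx s → ℝ) : l2 v ^ 2 = ∑ j, l2 (part j v) ^ 2 := by
  have h := dotProduct_bdiag_mulVec (1 : Mat s) v
  rw [bdiag_one] at h
  simpa only [Matrix.one_mulVec, ← l2_sq_eq_dotProduct] using h

theorem l2_mulVec_part {W : Mat s} (hW : bdiag (Wᵀ * W) = 1) (j : Fin t) (v : Idx s → ℝ) :
    l2 (W *ᵥ part j v) = l2 (part j v) := by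
  rw [← sq_eq_sq₀ (l2_nonneg _) (l2_nonneg _), l2_mulVec_sq, part_dotProduct_mulVec_part, hW,
    Matrix.one_mulVec, ← l2_sq_eq_dotProduct]

theorem l2_sum_le {κ : Type*} (S : Finset κ) (f : κ → Idx s → ℝ) :
    l2 (∑ k ∈ S, f k) ≤ ∑ k ∈ S, l2 (f k) := by
  rw [l2, WithLp.toLp_sum]
  exact norm_sum_le _ _

/-- A vector without `j`-th component is expanded by `W` by a factor of at most `√(t - 1)`. -/
theorem l2_mulVec_le_of_part_eq_zero {W : Mat s} (hW : bdiag (Wᵀ * W) = 1) {j : Fin t}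
    {v : Idx s → ℝ} (hv : part j v = 0) : l2 (W *ᵥ v) ≤ √((t : ℝ) - 1) * l2 v := by
  have ht : 1 ≤ t := j.pos
  have h1 : l2 (W *ᵥ v) ≤ ∑ k ∈ Finset.univ.erase j, l2 (part k v) := by
    conv_lhs => rw [← sum_part v, ← Finset.add_sum_erase _ _ (Finset.mem_univ j), hv, zero_add,
      Matrix.mulVec_sum]
    refine (l2_sum_le _ _).trans (le_of_eq (Finset.sum_congr rfl fun k _ => ?_))
    exact l2_mulVec_part hW k v
  have ht1 : (0 : ℝ) ≤ (t : ℝ) - 1 := by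
    have : (1 : ℝ) ≤ t := by exact_mod_cast ht
    linarith
  refine le_of_sq_le_sq ?_ (mul_nonneg (Real.sqrt_nonneg _) (l2_nonneg _))
  refine (pow_le_pow_left₀ (l2_nonneg _) h1 2).trans ?_
  refine sq_sum_le_card_mul_sum_sq.trans ?_
  rw [mul_pow, Real.sq_sqrt ht1, Finset.card_erase_of_mem (Finset.mem_univ _), Finset.card_univ,
    Fintype.card_fin, Nat.cast_sub ht, Nat.cast_one]
  refine mul_le_mul_of_nonneg_left ?_ ht1
  rw [l2_sq_eq_sum_part]
  exact Finset.sum_le_sum_of_subset_of_nonneg (Finset.erase_subset _ _) fun _ _ _ => sq_nonneg _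

theorem part_mulVec_part_eq_zero {P : Mat s} (hP : bdiag P = 0) (j : Fin t) (v : Idx s → ℝ) :
    part j (P *ᵥ part j v) = 0 := by
  ext x
  simp only [part, Pi.zero_apply]
  split_ifs with hx
  · refine Finset.sum_eq_zero fun y _ => ?_
    by_cases hy : y.1 = j
    · have := congrFun (congrFun hP x) y
      rw [bdiag_apply, if_pos (hx.trans hy.symm)] at this
      change P x y * part j v y = 0
      rw [this]
      exact zero_mul _
    · change P x y * part j v y = 0
      rw [part, if_neg hy, mul_zero]
  · rfl

/-- `W` is isometric on vectors supported in one block. `P` sends such a vector into the other `t -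
1` blocks, where `W` expands by at most `√(t - 1)`, so the triangle inequality applies on both
sides. -/
theorem l2_one_add_mulVec_part_bounds {W P : Mat s} (hW : bdiag (Wᵀ * W) = 1) (hP : bdiag P = 0)
    {x : ℝ} (hx : frobNorm P ≤ x) (j : Fin t) (v : Idx s → ℝ) :
    (1 - √((t : ℝ) - 1) * x) * l2 (part j v) ≤ l2 ((W * (1 + P)) *ᵥ part j v) ∧
      l2 ((W * (1 + P)) *ᵥ part j v) ≤ (1 + √((t : ℝ) - 1) * x) * l2 (part j v) := by
  set w := part j v with hw
  have hPw : l2 (P *ᵥ w) ≤ x * l2 w := by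
    refine le_of_sq_le_sq ?_ (mul_nonneg ((frobNorm_nonneg _).trans hx) (l2_nonneg _))
    rw [mul_pow, l2_sq, l2_sq]
    refine (sum_sq_mulVec_le_frobNorm P w).trans ?_
    exact mul_le_mul_of_nonneg_right (pow_le_pow_left₀ (frobNorm_nonneg _) hx 2)
      (Finset.sum_nonneg fun _ _ => sq_nonneg _)
  have h1 : l2 (W *ᵥ (P *ᵥ w)) ≤ √((t : ℝ) - 1) * x * l2 w := by
    refine (l2_mulVec_le_of_part_eq_zero hW (part_mulVec_part_eq_zero hP j v)).trans ?_
    rw [mul_assoc]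
    exact mul_le_mul_of_nonneg_left hPw (Real.sqrt_nonneg _)
  have h2 : (W * (1 + P)) *ᵥ w = W *ᵥ w + W *ᵥ (P *ᵥ w) := by
    rw [Matrix.mul_add, Matrix.mul_one, Matrix.add_mulVec, Matrix.mulVec_mulVec]
  have h3 : l2 (W *ᵥ w) = l2 w := l2_mulVec_part hW j v
  have h4 : l2 (W *ᵥ w + W *ᵥ (P *ᵥ w)) ≤ l2 (W *ᵥ w) + l2 (W *ᵥ (P *ᵥ w)) :=
    norm_add_le (WithLp.toLp 2 (W *ᵥ w)) (WithLp.toLp 2 (W *ᵥ (P *ᵥ w)))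
  have h5 : l2 (W *ᵥ w) - l2 (W *ᵥ (P *ᵥ w)) ≤ l2 (W *ᵥ w + W *ᵥ (P *ᵥ w)) := by
    have := norm_sub_norm_le (WithLp.toLp 2 (W *ᵥ w)) (-(WithLp.toLp 2 (W *ᵥ (P *ᵥ w))))
    rw [norm_neg, sub_neg_eq_add] at this
    exact this
  rw [h2]
  constructor <;> linarith

end Parts

/-! ### The distance between diagonalizers -/

section Distance

variable {t : ℕ} {s : Fin t → ℕ}

theorem permMatrix_mul_eq_submatrix (σ : Equiv.Perm (Idx s)) (M : Mat s) :
    σ.permMatrix ℝ * M = M.submatrix σ id :=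
  PEquiv.toMatrix_toPEquiv_mul σ M

theorem permMatrix_mul_transpose (σ : Equiv.Perm (Idx s)) :
    σ.permMatrix ℝ * (σ.permMatrix ℝ)ᵀ = 1 := by
  rw [permMatrix_mul_eq_submatrix]
  ext x y
  simp [Matrix.one_apply, PEquiv.toMatrix_apply]

theorem transpose_mul_permMatrix (σ : Equiv.Perm (Idx s)) :
    (σ.permMatrix ℝ)ᵀ * σ.permMatrix ℝ = 1 :=
  mul_eq_one_comm.1 (permMatrix_mul_transpose σ)

theorem permMatrix_conj_apply (σ : Equiv.Perm (Idx s)) (M : Mat s) (x y : Idx s) :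
    (σ.permMatrix ℝ * M * (σ.permMatrix ℝ)ᵀ) x y = M (σ x) (σ y) := by
  have h : σ.permMatrix ℝ * M * (σ.permMatrix ℝ)ᵀ
      = (σ.permMatrix ℝ * (σ.permMatrix ℝ * M)ᵀ)ᵀ := by
    rw [Matrix.transpose_mul, Matrix.transpose_transpose]
  rw [h, permMatrix_mul_eq_submatrix, permMatrix_mul_eq_submatrix]
  rfl

theorem permMatrix_transpose_conj_apply (σ : Equiv.Perm (Idx s)) (M : Mat s) (x y : Idx s) :
    ((σ.permMatrix ℝ)ᵀ * M * σ.permMatrix ℝ) x y = M (σ.symm x) (σ.symm y) := by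
  have h := permMatrix_conj_apply σ ((σ.permMatrix ℝ)ᵀ * M * σ.permMatrix ℝ) (σ.symm x) (σ.symm y)
  rw [σ.apply_symm_apply, σ.apply_symm_apply] at h
  rw [← h]
  have : σ.permMatrix ℝ * ((σ.permMatrix ℝ)ᵀ * M * σ.permMatrix ℝ) * (σ.permMatrix ℝ)ᵀ
      = (σ.permMatrix ℝ * (σ.permMatrix ℝ)ᵀ) * M * (σ.permMatrix ℝ * (σ.permMatrix ℝ)ᵀ) := by
    simp only [Matrix.mul_assoc]
  rw [this, permMatrix_mul_transpose, Matrix.one_mul, Matrix.mul_one]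

theorem permMatrix_mem_blockPermSet {σ : Equiv.Perm (Idx s)}
    (h : ∀ x y : Idx s, x.1 = y.1 → (σ x).1 = (σ y).1) :
    σ.permMatrix ℝ ∈ blockPermSet s := by
  refine ⟨⟨σ, rfl⟩, fun D hD => mem_blockDiagSet_iff.2 fun x y hxy => ?_⟩
  rw [permMatrix_transpose_conj_apply]
  refine mem_blockDiagSet_iff.1 hD _ _ fun h1 => hxy ?_
  simpa using h _ _ h1

theorem bdiag_permMatrix_conj_eq_one {σ : Equiv.Perm (Idx s)}
    (h : ∀ x y : Idx s, x.1 = y.1 → (σ x).1 = (σ y).1) {M : Mat s} (hM : bdiag M = 1) :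
    bdiag (σ.permMatrix ℝ * M * (σ.permMatrix ℝ)ᵀ) = 1 := by
  ext x y
  rw [bdiag_apply, permMatrix_conj_apply]
  split_ifs with hxy
  · have h1 := congrFun (congrFun hM (σ x)) (σ y)
    rw [bdiag_apply, if_pos (h x y hxy)] at h1
    rw [h1, Matrix.one_apply, Matrix.one_apply]
    simp only [σ.injective.eq_iff]
  · rw [Matrix.one_apply_ne fun h' => hxy (congrArg Sigma.fst h')]

/-- A norm for which multiplication from the right is bounded by the spectral norm. -/
def IsRightBounded (N : Mat s → ℝ) : Prop :=
  (∀ A, 0 ≤ N A) ∧ ∀ A B, N (A * B) ≤ N A * specNorm B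

theorem isRightBounded_of_mem {N : Mat s → ℝ} (hN : N ∈ ({specNorm, frobNorm} : Set (Mat s → ℝ))) :
    IsRightBounded N := by
  rcases hN with rfl | rfl
  · exact ⟨specNorm_nonneg, specNorm_mul_le⟩
  · exact ⟨frobNorm_nonneg, frobNorm_mul_le_mul_specNorm⟩

/-- If `W X = W̃ (I + P)` with `P` small and `X` a block permutation pattern, then `W` is close to
`W̃` up to the indeterminacies of block diagonalization. -/
theorem exists_mem_relDistSet_le {W W' P X : Mat s} (hW : bdiag (Wᵀ * W) = 1)
    (hW' : bdiag (W'ᵀ * W') = 1) (hP0 : bdiag P = 0) {x : ℝ} (hP : frobNorm P ≤ x)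
    (hx1 : √((t : ℝ) - 1) * x < 1) (hWX : W * X = W' * (1 + P))
    {π : Equiv.Perm (Fin t)} (hs : ∀ j, s (π j) = s j)
    (hπ : ∀ x y : Idx s, y.1 ≠ π x.1 → X x y = 0) {N : Mat s → ℝ} (hN : IsRightBounded N) :
    ∃ μ ∈ relDistSet N W W', μ ≤ (1 + x) / (1 - √((t : ℝ) - 1) * x) - 1 := by
  obtain ⟨σ, hσ⟩ := exists_perm_fst hs
  set a := √((t : ℝ) - 1) * x with ha
  have hx0 : 0 ≤ x := (frobNorm_nonneg P).trans hP
  have ha0 : 0 ≤ a := mul_nonneg (Real.sqrt_nonneg _) hx0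
  have h1a : 0 < 1 - a := sub_pos.2 hx1
  set R := σ.permMatrix ℝ with hR
  have hσ1 : ∀ x y : Idx s, x.1 = y.1 → (σ x).1 = (σ y).1 := fun x y hxy =>
    π.injective (by rw [hσ, hσ, hxy])
  set D := R * X with hDdef
  have hX : X = Rᵀ * D := by
    rw [hDdef, ← Matrix.mul_assoc, transpose_mul_permMatrix, Matrix.one_mul]
  have hD : D ∈ blockDiagSet s := mem_blockDiagSet_iff.2 fun x y hxy => by
    rw [hDdef, hR, permMatrix_mul_eq_submatrix]
    refine hπ (σ x) y fun h' => hxy ?_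
    rw [hσ] at h'
    exact h'.symm
  -- Take block diagonal parts of the Gram matrices of `W X = W' (1 + P)`. Block permutations
  -- preserve `Bdiag(Wᵀ W) = 1`, so the left side collapses to `Dᵀ D`.
  have hDD : Dᵀ * D = bdiag ((W' * (1 + P))ᵀ * (W' * (1 + P))) := by
    rw [← hWX, hX]
    have : (W * (Rᵀ * D))ᵀ * (W * (Rᵀ * D)) = Dᵀ * ((R * (Wᵀ * W) * Rᵀ) * D) := by
      simp only [Matrix.transpose_mul, Matrix.transpose_transpose, Matrix.mul_assoc]
    rw [this, bdiag_mul_of_mem_left (blockDiagSet_transpose hD), bdiag_mul_of_mem_right hD,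
      bdiag_permMatrix_conj_eq_one hσ1 hW, Matrix.one_mul]
  have hDv : ∀ v, ∑ i, (D *ᵥ v) i ^ 2 = ∑ j, l2 ((W' * (1 + P)) *ᵥ part j v) ^ 2 := fun v => by
    rw [← l2_sq, l2_mulVec_sq, hDD, dotProduct_bdiag_mulVec]
    simp only [l2_mulVec_sq]
  obtain ⟨K, hK, hDK, hK1, hK2⟩ := exists_inverse_polar_factor hD ha0 hx1
    (fun v => by
      rw [hDv, ← l2_sq, l2_sq_eq_sum_part, Finset.mul_sum]
      refine Finset.sum_le_sum fun j _ => ?_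
      rw [← mul_pow]
      exact pow_le_pow_left₀ (mul_nonneg h1a.le (l2_nonneg _))
        (l2_one_add_mulVec_part_bounds hW' hP0 hP j v).1 2)
    (fun v => by
      rw [hDv, ← l2_sq, l2_sq_eq_sum_part, Finset.mul_sum]
      refine Finset.sum_le_sum fun j _ => ?_
      rw [← mul_pow]
      exact pow_le_pow_left₀ (l2_nonneg _) (l2_one_add_mulVec_part_bounds hW' hP0 hP j v).2 2)
  set U := D * K with hU
  have hUU : U * Uᵀ = 1 := mul_eq_one_comm.1 hDK
  have hUb : Uᵀ ∈ blockDiagSet s := blockDiagSet_transpose (blockDiagSet_mul hD hK)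
  -- The candidate uses the transposed orthogonal polar factor `U = D K` and the permutation `R`. It
  -- comes from `W Rᵀ U = W' (1 + P) K`, in which `(1 + P) K` is close to `1`.
  refine ⟨N (W - W' * Uᵀ * R) / N W', ⟨Uᵀ, hUb, by rw [Matrix.transpose_transpose]; exact hUU, R,
    permMatrix_mem_blockPermSet hσ1, rfl⟩, ?_⟩
  have hrep : W - W' * Uᵀ * R = W' * (((K - 1) + P * K) * (Uᵀ * R)) := by
    have h1 : W' * ((K - 1) + P * K) = W * Rᵀ * U - W' := by
      have : W' * ((K - 1) + P * K) = (W' * (1 + P)) * K - W' := by noncomm_ring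
      rw [this, ← hWX, hX, hU]
      simp only [Matrix.mul_assoc]
    rw [← Matrix.mul_assoc, h1, Matrix.sub_mul]
    have h2 : W * Rᵀ * U * (Uᵀ * R) = W * (Rᵀ * (U * Uᵀ) * R) := by simp only [Matrix.mul_assoc]
    rw [h2, hUU, Matrix.mul_one, transpose_mul_permMatrix, Matrix.mul_one, Matrix.mul_assoc]
  have hPn : specNorm P ≤ x := (specNorm_le_frobNorm P).trans hP
  have h1 : specNorm ((K - 1) + P * K) ≤ (1 + x) / (1 - a) - 1 := by
    refine (specNorm_add_le _ _).trans ?_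
    have h2 : specNorm (P * K) ≤ x * (1 / (1 - a)) :=
      (specNorm_mul_le _ _).trans (mul_le_mul hPn hK1 (specNorm_nonneg _) hx0)
    have h3 : (1 + x) / (1 - a) - 1 = (1 / (1 - a) - 1) + x * (1 / (1 - a)) := by ring
    rw [h3]
    exact add_le_add hK2 h2
  have h2 : specNorm (Uᵀ * R) ≤ 1 := by
    refine specNorm_le_one_of_orthogonal ?_
    rw [Matrix.transpose_mul, Matrix.transpose_transpose]
    have : Rᵀ * U * (Uᵀ * R) = Rᵀ * (U * Uᵀ) * R := by simp only [Matrix.mul_assoc]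
    rw [this, hUU, Matrix.mul_one, transpose_mul_permMatrix]
  have h3 : specNorm (((K - 1) + P * K) * (Uᵀ * R)) ≤ (1 + x) / (1 - a) - 1 :=
    (specNorm_mul_le _ _).trans ((mul_le_of_le_one_right (specNorm_nonneg _) h2).trans h1)
  have h0 : 0 ≤ (1 + x) / (1 - a) - 1 := (specNorm_nonneg _).trans h3
  refine div_le_of_le_mul₀ (hN.1 _) h0 ?_
  rw [hrep, mul_comm]
  exact (hN.2 _ _).trans (mul_le_mul_of_nonneg_left h3 (hN.1 _))

end Distance

/-! ### The minimum is attained -/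

section Attained

variable {t : ℕ} {s : Fin t → ℕ}

theorem continuous_frobNorm : Continuous (frobNorm : Mat s → ℝ) := by
  have : (frobNorm : Mat s → ℝ) = fun M => √(∑ i, ∑ j, M i j ^ 2) := funext frobNorm_eq_sqrt
  rw [this]
  refine Real.continuous_sqrt.comp (continuous_finsetSum _ fun i _ =>
    continuous_finsetSum _ fun j _ => ?_)
  exact (continuous_id.matrix_elem i j).pow 2

open scoped Matrix.Norms.L2Operator in
theorem continuous_specNorm : Continuous (specNorm : Mat s → ℝ) := continuous_norm

theorem continuous_of_mem {N : Mat s → ℝ} (hN : N ∈ ({specNorm, frobNorm} : Set (Mat s → ℝ))) :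
    Continuous N := by
  rcases hN with rfl | rfl
  · exact continuous_specNorm
  · exact continuous_frobNorm

theorem isCompact_orthogonal_blockDiag :
    IsCompact {D : Mat s | D ∈ blockDiagSet s ∧ Dᵀ * D = 1} := by
  have hbox : IsCompact {D : Mat s | ∀ x y : Idx s, D x y ∈ Set.Icc (-1 : ℝ) 1} := by
    have h : IsCompact (Set.univ.pi fun _ : Idx s => Set.univ.pi fun _ : Idx s =>
        Set.Icc (-1 : ℝ) 1) := isCompact_univ_pi fun _ => isCompact_univ_pi fun _ => isCompact_Icc
    have h' : (Set.univ.pi fun _ : Idx s => Set.univ.pi fun _ : Idx s => Set.Icc (-1 : ℝ) 1)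
        = {D : Mat s | ∀ x y : Idx s, D x y ∈ Set.Icc (-1 : ℝ) 1} :=
      Set.ext fun D => ⟨fun hD x y => hD x trivial y trivial, fun hD x _ y _ => hD x y⟩
    exact h' ▸ h
  refine hbox.of_isClosed_subset ?_ ?_
  · have h1 : IsClosed {D : Mat s | ∀ x y : Idx s, x.1 ≠ y.1 → D x y = 0} := by
      simp only [Set.ofPred_forall]
      exact isClosed_iInter fun x => isClosed_iInter fun y => isClosed_iInter fun _ =>
        isClosed_eq (continuous_id.matrix_elem x y) continuous_const
    have h2 : IsClosed {D : Mat s | Dᵀ * D = 1} :=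
      isClosed_eq (continuous_id.matrix_transpose.matrix_mul continuous_id) continuous_const
    have h3 := h1.inter h2
    simp only [mem_blockDiagSet_iff]
    exact h3
  · rintro D ⟨-, hD⟩ x y
    have h1 := congrFun (congrFun hD y) y
    rw [Matrix.mul_apply, Matrix.one_apply_eq] at h1
    have h2 : D x y ^ 2 ≤ 1 := by
      rw [← h1, sq]
      exact Finset.single_le_sum (f := fun z => Dᵀ y z * D z y)
        (fun z _ => mul_self_nonneg (D z y)) (Finset.mem_univ x)
    exact abs_le.1 ((sq_le_one_iff_abs_le_one _).1 h2)

/-- There are finitely many permutation matrices, and for each of them the distances form a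
continuous image of the compact set of orthogonal block diagonal matrices. -/
theorem exists_isLeast_relDistSet {N : Mat s → ℝ} (hN : Continuous N) (W W' : Mat s)
    (hne : (relDistSet N W W').Nonempty) : ∃ μ, IsLeast (relDistSet N W W') μ := by
  have hfin : (blockPermSet s).Finite :=
    (Set.finite_range fun σ : Equiv.Perm (Idx s) => σ.permMatrix ℝ).subset fun P hP => by
      obtain ⟨σ, hσ⟩ := hP.1
      exact ⟨σ, hσ.symm⟩
  have h : relDistSet N W W' = ⋃ P ∈ blockPermSet s,
      (fun D => N (W - W' * D * P) / N W') '' {D : Mat s | D ∈ blockDiagSet s ∧ Dᵀ * D = 1} := by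
    ext μ
    simp only [relDistSet, Set.mem_ofPred_eq, Set.mem_iUnion, Set.mem_image]
    constructor
    · rintro ⟨D, hD, hD', P, hP, rfl⟩
      exact ⟨P, hP, D, ⟨hD, hD'⟩, rfl⟩
    · rintro ⟨P, hP, D, ⟨hD, hD'⟩, rfl⟩
      exact ⟨D, hD, hD', P, hP, rfl⟩
  refine IsCompact.exists_isLeast ?_ hne
  rw [h]
  refine hfin.isCompact_biUnion fun P _ => isCompact_orthogonal_blockDiag.image ?_
  refine (hN.comp ?_).div_const _
  exact continuous_const.sub ((continuous_const.matrix_mul continuous_id).matrix_mul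
    continuous_const)

end Attained

/-! ### The constants and the bound -/

section Constants

variable {t : ℕ}

theorem one_le_sub_one (ht : 2 ≤ t) : (1 : ℝ) ≤ (t : ℝ) - 1 := by
  have : (2 : ℝ) ≤ t := by exact_mod_cast ht
  linarith

theorem one_lt_sqrt_two : (1 : ℝ) < √2 := Real.lt_sqrt_of_sq_lt (by norm_num)

theorem tau_pos (ht : 2 ≤ t) : 0 < tau t :=
  div_pos (sub_pos.2 one_lt_sqrt_two) (Real.sqrt_pos.2 (by linarith [one_le_sub_one ht]))

theorem sqrt_mul_tau (ht : 2 ≤ t) : √((t : ℝ) - 1) * tau t = √2 - 1 :=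
  mul_div_cancel₀ _ (Real.sqrt_pos.2 (by linarith [one_le_sub_one ht])).ne'

theorem tau_le (ht : 2 ≤ t) : tau t ≤ √2 - 1 := by
  rw [← sqrt_mul_tau ht]
  exact le_mul_of_one_le_left (tau_pos ht).le (Real.one_le_sqrt.2 (one_le_sub_one ht))

theorem alpha_pos (ht : 2 ≤ t) : 0 < alpha t := by
  have := tau_pos ht
  unfold alpha
  positivity

/-- The right side is the growth factor of `mul_frobNorm_riccatiMap_le` at `x = τ`. This is what `α`
is designed for: with `ε_* ≤ τ`, the ball of radius `ε_*` is mapped into itself. -/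
theorem tau_div_alpha (ht : 2 ≤ t) : tau t / alpha t = 1 + √2 * tau t + tau t ^ 2 / 2 := by
  have h := tau_pos ht
  have h2 : √2 ^ 2 = (2 : ℝ) := Real.sq_sqrt (by norm_num)
  have h3 : 0 < √2 + tau t := by positivity
  rw [alpha, div_eq_iff (by positivity)]
  field_simp
  linear_combination h2

theorem alpha_lt (ht : 2 ≤ t) : alpha t < 1 / 4 := by
  have h := tau_pos ht
  have h1 := tau_le ht
  have h2 : √2 ^ 2 = (2 : ℝ) := Real.sq_sqrt (by norm_num)
  have h3 : √2 < 1.415 := by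
    rw [Real.sqrt_lt' (by norm_num)]
    norm_num
  rw [alpha, div_lt_iff₀ (by positivity)]
  nlinarith [mul_nonneg h.le (sub_nonneg.2 h1), one_lt_sqrt_two]

theorem one_add_div_le_errBound (ht : 2 ≤ t) {x : ℝ} (hx0 : 0 ≤ x) (hx : x < tau t) :
    (1 + x) / (1 - √((t : ℝ) - 1) * x) - 1 ≤ errBound t x := by
  have ht1 := one_le_sub_one ht
  have hs1 : 0 < √((t : ℝ) - 1) := Real.sqrt_pos.2 (by linarith)
  have hsq : √((t : ℝ) - 1) ^ 2 = (t : ℝ) - 1 := Real.sq_sqrt (by linarith)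
  have h2 : √2 ^ 2 = (2 : ℝ) := Real.sq_sqrt (by norm_num)
  have ha : √((t : ℝ) - 1) * x < √2 - 1 := by
    rw [← sqrt_mul_tau ht]
    exact mul_lt_mul_of_pos_left hx hs1
  have ha0 : 0 ≤ √((t : ℝ) - 1) * x := mul_nonneg hs1.le hx0
  rw [errBound]
  have hrad : 1 - 2 * √((t : ℝ) - 1) * x - ((t : ℝ) - 1) * x ^ 2
      = 1 - 2 * (√((t : ℝ) - 1) * x) - (√((t : ℝ) - 1) * x) ^ 2 := by
    rw [mul_pow, hsq]
    ring
  rw [hrad]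
  set a := √((t : ℝ) - 1) * x
  -- The positive root of `1 - 2 a - a²` is `√2 - 1`, which explains the numerator of `tau`.
  have hpos : 0 < 1 - 2 * a - a ^ 2 := by nlinarith
  -- The radicand is at most `(1 - a)² = 1 - 2 a + a²`, so the bound obtained from the polar factor
  -- is sharper than the stated one.
  have hs : √(1 - 2 * a - a ^ 2) ≤ 1 - a := by
    rw [Real.sqrt_le_left (by nlinarith [one_lt_sqrt_two])]
    nlinarith
  have ht2 : 1 ≤ √(t : ℝ) := Real.one_le_sqrt.2 (by linarith)
  refine sub_le_sub_right (div_le_div₀ (by positivity) ?_ (Real.sqrt_pos.2 hpos) hs) _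
  exact add_le_add le_rfl (le_mul_of_one_le_left hx0 ht2)

theorem inv_sqrt_one_sub_bounds {u : ℝ} (hu0 : 0 ≤ u) (hu : u ≤ 1 / 2) :
    1 + u / 2 ≤ 1 / √(1 - u) ∧ 1 / √(1 - u) ≤ 1 + u / 2 + u ^ 2 := by
  have h1 : 0 < 1 - u := by linarith
  have hs := Real.sqrt_pos.2 h1
  constructor
  · rw [le_div_iff₀ hs]
    refine le_of_sq_le_sq ?_ zero_le_one
    rw [mul_pow, Real.sq_sqrt h1.le]
    nlinarith [mul_nonneg hu0 hu0, mul_nonneg (mul_nonneg hu0 hu0) hu0]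
  · rw [div_le_iff₀ hs]
    refine le_of_sq_le_sq ?_ (by positivity)
    rw [mul_pow, Real.sq_sqrt h1.le]
    have h2 : 0 ≤ 5 / 4 - 5 / 4 * u - u ^ 3 := by
      have : u ^ 3 ≤ (1 / 2) ^ 3 := pow_le_pow_left₀ hu0 hu 3
      linarith
    have h3 : (1 + u / 2 + u ^ 2) ^ 2 * (1 - u) = 1 + u ^ 2 * (5 / 4 - 5 / 4 * u - u ^ 3) := by ring
    rw [h3]
    nlinarith [mul_nonneg (sq_nonneg u) h2]

theorem abs_errBound_sub_le (ht : 2 ≤ t) {x : ℝ} (hx0 : 0 ≤ x) (hx : √(t : ℝ) * x ≤ 1 / 8) :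
    |errBound t x - (√(t : ℝ) + √((t : ℝ) - 1)) * x| ≤ 20 * t * x ^ 2 := by
  have ht1 := one_le_sub_one ht
  have hsq : √((t : ℝ) - 1) ^ 2 = (t : ℝ) - 1 := Real.sq_sqrt (by linarith)
  have hsq' : √(t : ℝ) ^ 2 = t := Real.sq_sqrt (by linarith)
  have hle : √((t : ℝ) - 1) ≤ √(t : ℝ) := Real.sqrt_le_sqrt (by linarith)
  have hrad : 1 - 2 * √((t : ℝ) - 1) * x - ((t : ℝ) - 1) * x ^ 2
      = 1 - (2 * (√((t : ℝ) - 1) * x) + (√((t : ℝ) - 1) * x) ^ 2) := by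
    rw [mul_pow, hsq]
    ring
  have hR : 20 * (t : ℝ) * x ^ 2 = 20 * (√(t : ℝ) * x) ^ 2 := by
    rw [mul_pow, hsq']
    ring
  rw [errBound, hrad, hR, add_mul, div_eq_mul_one_div]
  have hab : √((t : ℝ) - 1) * x ≤ √(t : ℝ) * x := mul_le_mul_of_nonneg_right hle hx0
  have ha0 : 0 ≤ √((t : ℝ) - 1) * x := mul_nonneg (Real.sqrt_nonneg _) hx0
  generalize √((t : ℝ) - 1) * x = a at *
  generalize √(t : ℝ) * x = b at *
  have hu0 : 0 ≤ 2 * a + a ^ 2 := by positivity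
  have hu3 : 2 * a + a ^ 2 ≤ 3 * a := by nlinarith
  obtain ⟨h1, h2⟩ := inv_sqrt_one_sub_bounds hu0 (by linarith)
  have hu9 : (2 * a + a ^ 2) ^ 2 ≤ 9 * a ^ 2 := by nlinarith
  generalize 1 / √(1 - (2 * a + a ^ 2)) = y at *
  have hb0 : 0 ≤ b := ha0.trans hab
  have hy2 : y ≤ 1 + a + 19 / 2 * a ^ 2 := by linarith
  have hy1 : 1 + a ≤ y := by nlinarith
  have haa : a ^ 2 ≤ b ^ 2 := pow_le_pow_left₀ ha0 hab 2
  have hab2 : a * b ≤ b ^ 2 := by nlinarith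
  refine abs_le.2 ⟨?_, ?_⟩
  · nlinarith [mul_nonneg ha0 hb0, mul_le_mul_of_nonneg_left hy1 (by linarith : 0 ≤ 1 + b)]
  -- The constant `20` is `19 + 1`: the quadratic error `19 / 2 a²` is doubled by the factor `1 + b
  -- ≤ 2`, and the product `a b` contributes one more `b²`.
  · have h3 := mul_le_mul_of_nonneg_left hy2 (by linarith : 0 ≤ 1 + b)
    have h4 : (1 + b) * (19 / 2 * a ^ 2) ≤ 2 * (19 / 2 * a ^ 2) :=
      mul_le_mul_of_nonneg_right (by linarith) (by positivity)
    nlinarith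

end Constants

/-! ### The perturbation bound -/

section Main

variable {t : ℕ} {s : Fin t → ℕ} {m : ℕ}

theorem gap_nonneg (γ : Fin t → ℝ) : 0 ≤ gap γ := Real.iInf_nonneg fun _ => abs_nonneg _

theorem gap_le (γ : Fin t → ℝ) {j k : Fin t} (h : j ≠ k) : gap γ ≤ |γ j - γ k| :=
  ciInf_le (Set.finite_range fun p : {p : Fin t × Fin t // p.1 ≠ p.2} =>
    |γ p.1.1 - γ p.1.2|).bddBelow ⟨(j, k), h⟩

theorem delta_nonneg (A A' : Fin m → Mat s) (W W' : Mat s) (γ : Fin t → ℝ) :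
    0 ≤ delta A A' W W' γ := by
  have h1 := specNorm_nonneg (W⁻¹ * W')⁻¹
  have h2 := specNorm_nonneg W
  have h3 := specNorm_nonneg W'
  have h4 := famNorm_nonneg (residual A' W' γ)
  have h5 := famNorm_nonneg fun i => A' i - A i
  unfold delta
  positivity

theorem cond2_nonneg (Q : Mat s) : 0 ≤ cond2 Q := mul_nonneg (specNorm_nonneg _) (specNorm_nonneg _)

open scoped Matrix.Norms.Frobenius in
theorem isUnit_one_add_of_frobNorm_lt_one {P : Mat s} (hP : frobNorm P < 1) : IsUnit (1 + P) := by
  have : CompleteSpace (Mat s) := FiniteDimensional.complete ℝ _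
  have h := isUnit_one_sub_of_norm_lt_one (x := -P) (by rw [norm_neg]; exact hP)
  rwa [sub_neg_eq_add] at h

theorem omegaRobu_le (A : Fin m → Mat s) (W : Mat s) {j : Fin t} (hj : 1 < s j) {k : ℕ}
    (hk : singVal (diagG (diagBlocks A W j)) k ≠ 0) :
    omegaRobu A W ≤ (singVal (diagG (diagBlocks A W j)) k : ℝ) :=
  (iInf₂_le j hj).trans (iInf₂_le k hk)

/-- `ω_robu` may be `∞`; this replaces it by a real lower bound that still satisfies the hypothesis
on `δ`. -/
theorem exists_real_le_of_lt_mul {δ c : ℝ} (hc : 0 < c) {ω : EReal}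
    (h : (δ : EReal) < (c : EReal) * ω) : ∃ r : ℝ, (r : EReal) ≤ ω ∧ δ < c * r := by
  induction ω with
  | bot =>
    rw [EReal.coe_mul_bot_of_pos hc] at h
    exact absurd h not_lt_bot
  | coe r => exact ⟨r, le_rfl, by exact_mod_cast h⟩
  | top =>
    refine ⟨(δ + 1) / c, le_top, ?_⟩
    rw [mul_div_cancel₀ _ hc.ne']
    linarith

open scoped Matrix.Norms.Frobenius in
theorem exists_scalar_norm_blk_sub_lt {A : Fin m → Mat s} {W Z : Mat s} (hs : ∀ j, 0 < s j)
    (hW : IsBlockDiagonalizer A W)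
    (hdim : ∀ j, Module.finrank ℝ (nullSpace (diagBlocks A W j)) = 1) {δ c : ℝ} (hδ : 0 ≤ δ)
    (hZ : (famNorm fun i => Wᵀ * A i * W * Z - Zᵀ * (Wᵀ * A i * W)) ≤ δ) (hc : 0 < c)
    (h : (δ : EReal) < (c : EReal) * omegaRobu A W) (j : Fin t) :
    ∃ z : ℝ, ‖blk Z j j - z • (1 : Matrix (Fin (s j)) (Fin (s j)) ℝ)‖ < c := by
  rcases (Nat.succ_le_of_lt (hs j)).eq_or_lt with hj | hj
  · have hsub : Subsingleton (Fin (s j)) := by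
      rw [← hj]
      infer_instance
    refine ⟨blk Z j j ⟨0, hs j⟩ ⟨0, hs j⟩, ?_⟩
    have : blk Z j j - blk Z j j ⟨0, hs j⟩ ⟨0, hs j⟩ • (1 : Matrix (Fin (s j)) (Fin (s j)) ℝ)
        = 0 := by
      ext a b
      rw [Subsingleton.elim a ⟨0, hs j⟩, Subsingleton.elim b ⟨0, hs j⟩]
      simp
    rw [this, norm_zero]
    exact hc
  · obtain ⟨r, hr, hδr⟩ := exists_real_le_of_lt_mul hc h
    have hr0 : 0 < r := pos_of_mul_pos_right (hδ.trans_lt hδr) hc.le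
    obtain ⟨z, hz⟩ := exists_scalar_mul_norm_blk_sub_le hW Z (hs j) (hdim j) hr0.le fun k hk => by
      exact_mod_cast hr.trans (omegaRobu_le A W hj hk)
    refine ⟨z, lt_of_mul_lt_mul_left ?_ hr0.le⟩
    rw [mul_comm r c]
    exact (hz.trans hZ).trans_lt hδr

theorem bdiag_conj_mul {Q : Mat s} (hQ : IsUnit Q.det) (G : Mat s) :
    bdiag (Q * G * Q⁻¹) * Q = Q * (G + -(Q⁻¹ * offBdiag (Q * G * Q⁻¹) * Q)) := by
  have h : bdiag (Q * G * Q⁻¹) = Q * G * Q⁻¹ - offBdiag (Q * G * Q⁻¹) := by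
    rw [offBdiag, sub_sub_cancel]
  rw [h, Matrix.sub_mul, Matrix.mul_add, Matrix.mul_neg, ← Matrix.mul_assoc Q,
    ← Matrix.mul_assoc Q, Matrix.mul_nonsing_inv _ hQ, Matrix.one_mul,
    Matrix.mul_assoc _ Q⁻¹ Q, Matrix.nonsing_inv_mul _ hQ, Matrix.mul_one, sub_eq_add_neg]

theorem exists_mem_relDistSet_le_errBound (ht : 2 ≤ t) (hs : ∀ j, 0 < s j) {A A' : Fin m → Mat s}
    {W W' : Mat s} {γ : Fin t → ℝ} (hW : W ∈ normalizedSet s) (hA : IsBlockDiagonalizer A W)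
    (hdim : ∀ j, Module.finrank ℝ (nullSpace (diagBlocks A W j)) = 1) (hW' : W' ∈ normalizedSet s)
    (hinj : Function.Injective γ) (hγ : ∀ j, |γ j| ≤ 1)
    (huniq : delta A A' W W' γ < alpha t * gap γ * omegaUniq A W / cond2 (W⁻¹ * W'))
    (hrobu : (delta A A' W W' γ : EReal)
      < (((1 - 2 * alpha t) * gap γ / √2 : ℝ) : EReal) * omegaRobu A W)
    {N : Mat s → ℝ} (hN : IsRightBounded N) :
    ∃ μ ∈ relDistSet N W W', μ ≤ errBound t (epsStar t (cond2 (W⁻¹ * W')) (gap γ)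
      (omegaUniq A W) (delta A A' W W' γ)) := by
  have hα := alpha_pos ht
  have hα4 := alpha_lt ht
  have hτ := tau_pos ht
  have hτ2 := tau_le ht
  have hδ := delta_nonneg A A' W W' γ
  have hZ := famNorm_residual_le_delta A A' hW.1 hW'.1 hγ
  have hdet := (Matrix.isUnit_iff_isUnit_det _).1 hW.1
  have hQ : IsUnit (W⁻¹ * W') :=
    ((Matrix.isUnit_nonsing_inv_iff).2 hW.1).mul hW'.1
  have hWQ : W * (W⁻¹ * W') = W' := by
    rw [← Matrix.mul_assoc, Matrix.mul_nonsing_inv _ hdet, Matrix.one_mul]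
  set Q := W⁻¹ * W' with hQdef
  have hQdet := (Matrix.isUnit_iff_isUnit_det _).1 hQ
  set δ := delta A A' W W' γ
  set Z := Q * gammaMat s γ * Q⁻¹ with hZdef
  set g := gap γ with hg
  set ω := omegaUniq A W with hω
  set κ := cond2 Q with hκ
  have hg0 : 0 ≤ g := gap_nonneg γ
  have hω0 : 0 ≤ ω := omegaUniq_nonneg
  have hκ0 : 0 ≤ κ := cond2_nonneg Q
  have hrhs := hδ.trans_lt huniq
  -- If `κ`, `g` or `ω` were zero, the bound on `δ` would be zero (for `κ` by the convention `x / 0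
  -- = 0`), contradicting `0 ≤ δ`.
  have hκp : 0 < κ := hκ0.lt_of_ne fun h => by simp [← h] at hrhs
  have hgp : 0 < g := hg0.lt_of_ne fun h => by simp [← h] at hrhs
  have hωp : 0 < ω := hω0.lt_of_ne fun h => by simp [← h] at hrhs
  rw [lt_div_iff₀ hκp] at huniq
  set E : Mat s := -(Q⁻¹ * offBdiag Z * Q) with hE
  have hEω : frobNorm E * ω ≤ κ * δ := by
    have h1 : frobNorm E ≤ κ * frobNorm (offBdiag Z) := by
      rw [hE, frobNorm_neg]
      refine (frobNorm_mul_le_mul_specNorm _ _).trans ?_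
      refine (mul_le_mul_of_nonneg_right (frobNorm_mul_le_specNorm_mul _ _)
        (specNorm_nonneg _)).trans (le_of_eq ?_)
      rw [hκ, cond2]
      ring
    have h2 : ω * frobNorm (offBdiag Z) ≤ δ := (omegaUniq_mul_frobNorm_offBdiag_le hA Z).trans hZ
    calc frobNorm E * ω ≤ κ * frobNorm (offBdiag Z) * ω := mul_le_mul_of_nonneg_right h1 hω0
      _ = κ * (ω * frobNorm (offBdiag Z)) := by ring
      _ ≤ κ * δ := mul_le_mul_of_nonneg_left h2 hκ0
  have hEg : frobNorm E < alpha t * g := by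
    refine lt_of_mul_lt_mul_right ?_ hω0
    linarith
  have hE0 := frobNorm_nonneg E
  set x := epsStar t κ g ω δ with hx
  have hx0 : 0 ≤ x := by
    rw [hx, epsStar]
    positivity
  have hgx : g * x = tau t / alpha t * (κ * δ / ω) := by
    rw [hx, epsStar]
    field_simp
  have hxτ : x < tau t := by
    rw [hx, epsStar, div_lt_iff₀ (by positivity)]
    nlinarith
  have hEx : tau t / alpha t * frobNorm E ≤ g * x := by
    rw [hgx]
    exact mul_le_mul_of_nonneg_left ((le_div_iff₀ hωp).2 hEω) (div_pos hτ hα).le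
  have hx2 : x ≤ √2 - 1 := hxτ.le.trans hτ2
  have hball : frobNorm E * (1 + √2 * x + x ^ 2 / 2) ≤ g * x := by
    refine le_trans ?_ hEx
    rw [tau_div_alpha ht, mul_comm]
    refine mul_le_mul_of_nonneg_right ?_ hE0
    have h1 : √2 * x ≤ √2 * tau t := mul_le_mul_of_nonneg_left hxτ.le (Real.sqrt_nonneg _)
    have h2 : x ^ 2 ≤ tau t ^ 2 := pow_le_pow_left₀ hx0 hxτ.le 2
    linarith
  have hsqrt2 : √2 < 2 := by
    rw [Real.sqrt_lt' (by norm_num)]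
    norm_num
  -- Here `x < 1` and `α < 1 / 4` suffice. Halving the inequality also gives the smallness `‖E‖_F (1
  -- + x) ≤ g / 2` needed for separating the spectra.
  have hcontr : frobNorm E * (2 + 2 * x) < g := by
    have h1 : frobNorm E * (2 + 2 * x) ≤ frobNorm E * 4 :=
      mul_le_mul_of_nonneg_left (by linarith) hE0
    have h2 : alpha t * g < 1 / 4 * g := mul_lt_mul_of_pos_right hα4 hgp
    linarith
  have hgap : ∀ j k, j ≠ k → g ≤ |γ j - γ k| := fun j k hjk => gap_le γ hjk
  obtain ⟨P, hPx, hP0, hP⟩ := exists_block_diagonalization hinj hgp hgap E hx0 hx2 hball hcontr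
  have hX : bdiag Z * (Q * (1 + P)) = Q * (1 + P) * (gammaMat s γ + bdiag (E * (1 + P))) := by
    have h2 := bdiag_conj_mul hQdet (gammaMat s γ)
    rw [← Matrix.mul_assoc (bdiag Z) Q, h2, Matrix.mul_assoc Q, hP, ← Matrix.mul_assoc Q]
  have hXu : IsUnit (Q * (1 + P)) :=
    hQ.mul (isUnit_one_add_of_frobNorm_lt_one (by linarith))
  have hc : 0 < (1 - 2 * alpha t) * g / √2 :=
    div_pos (mul_pos (by linarith) hgp) (by linarith [one_lt_sqrt_two])
  obtain ⟨π, hπs, hπ⟩ := exists_perm_of_blk_subsingleton hs hXu fun j k l hk hl => by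
    obtain ⟨z, hz⟩ := exists_scalar_norm_blk_sub_lt hs hA hdim hδ hZ hc hrobu j
    -- The two hypotheses on `δ` fit together here: `√2 ‖Z_jj - z‖ < (1 - 2 α) g` and `2 ‖E‖_F < 2 α
    -- g` add up to less than `g`.
    refine eq_of_blk_ne_zero hgap hPx (by linarith) hP0 hP hX (z := z) ?_ hk hl
    rw [lt_div_iff₀ (by linarith [one_lt_sqrt_two])] at hz
    linarith
  have hax : √((t : ℝ) - 1) * x < 1 := by
    have h1 : √((t : ℝ) - 1) * x ≤ √2 - 1 := by
      rw [← sqrt_mul_tau ht]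
      exact mul_le_mul_of_nonneg_left hxτ.le (Real.sqrt_nonneg _)
    linarith
  obtain ⟨μ, hμ, hμ'⟩ := exists_mem_relDistSet_le hW.2 hW'.2 hP0 hPx hax
    (by rw [← Matrix.mul_assoc, hWQ]) hπs hπ hN
  exact ⟨μ, hμ, hμ'.trans (one_add_div_le_errBound ht hx0 hxτ)⟩

theorem abs_errBound_epsStar_sub_le (ht : 2 ≤ t) {κ g ω d : ℝ} (hκ : 0 ≤ κ) (hg : 0 ≤ g)
    (hω : 0 ≤ ω) (hd : 0 ≤ d) (h : κ * d / (g * ω) ≤ 1 / (8 * (tau t / alpha t) * √(t : ℝ))) :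
    |errBound t (epsStar t κ g ω d)
        - tau t / alpha t * ((√(t : ℝ) + √((t : ℝ) - 1)) * κ * d / (g * ω))|
      ≤ 20 * t * (tau t / alpha t) ^ 2 * (κ * d / (g * ω)) ^ 2 := by
  have hc : 0 < tau t / alpha t := div_pos (tau_pos ht) (alpha_pos ht)
  have ht0 : 0 < √(t : ℝ) := Real.sqrt_pos.2 (by linarith [one_le_sub_one ht])
  have h1 : epsStar t κ g ω d = tau t / alpha t * (κ * d / (g * ω)) := by
    rw [epsStar, div_mul_div_comm, mul_assoc, mul_assoc]
  have h2 : tau t / alpha t * ((√(t : ℝ) + √((t : ℝ) - 1)) * κ * d / (g * ω))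
      = (√(t : ℝ) + √((t : ℝ) - 1)) * (tau t / alpha t * (κ * d / (g * ω))) := by ring
  rw [h1, h2]
  generalize tau t / alpha t = c at *
  have hX : 0 ≤ κ * d / (g * ω) := by positivity
  generalize κ * d / (g * ω) = X at *
  refine (abs_errBound_sub_le ht (mul_nonneg hc.le hX) ?_).trans (le_of_eq (by ring))
  rw [le_div_iff₀ (by positivity)] at h
  linarith

end Main

end JBD

end

/-- The constants `C` and `η` of the first-order expansion depend only on `t`. -/
theorem theorem3p1 (t : ℕ) (ht : 2 ≤ t) :
    ∃ C > (0 : ℝ), ∃ η > (0 : ℝ),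
      ∀ (s : Fin t → ℕ) (_ : ∀ j, 0 < s j) (m : ℕ)
        (A A' : Fin m → JBD.Mat s) (W W' : JBD.Mat s) (γ : Fin t → ℝ)
        (_ : W ∈ JBD.normalizedSet s) (_ : JBD.IsBlockDiagonalizer A W)
        (_ : ∀ j, Module.finrank ℝ (JBD.nullSpace (JBD.diagBlocks A W j)) = 1)
        (_ : W' ∈ JBD.normalizedSet s)
        (_ : Function.Injective γ) (_ : ∀ j, |γ j| ≤ 1)
        (_ : (JBD.delta A A' W W' γ : EReal) <
          min ((JBD.alpha t * JBD.gap γ * JBD.omegaUniq A W / JBD.cond2 (W⁻¹ * W') : ℝ) : EReal)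
            ((((1 - 2 * JBD.alpha t) * JBD.gap γ / √2 : ℝ) : EReal) * JBD.omegaRobu A W)),
        (∀ N ∈ ({JBD.specNorm, JBD.frobNorm} : Set (JBD.Mat s → ℝ)),
          ∃ μ : ℝ, IsLeast (JBD.relDistSet N W W') μ ∧
            μ ≤ JBD.errBound t (JBD.epsStar t (JBD.cond2 (W⁻¹ * W')) (JBD.gap γ)
              (JBD.omegaUniq A W) (JBD.delta A A' W W' γ))) ∧
        ∀ d : ℝ, 0 ≤ d → JBD.cond2 (W⁻¹ * W') * d / (JBD.gap γ * JBD.omegaUniq A W) ≤ η →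
          |JBD.errBound t (JBD.epsStar t (JBD.cond2 (W⁻¹ * W')) (JBD.gap γ)
              (JBD.omegaUniq A W) d)
            - JBD.tau t / JBD.alpha t * ((√(t : ℝ) + √((t : ℝ) - 1)) * JBD.cond2 (W⁻¹ * W') * d
                / (JBD.gap γ * JBD.omegaUniq A W))|
            ≤ C * (JBD.cond2 (W⁻¹ * W') * d / (JBD.gap γ * JBD.omegaUniq A W)) ^ 2 := by
  have hc : 0 < JBD.tau t / JBD.alpha t := div_pos (JBD.tau_pos ht) (JBD.alpha_pos ht)
  have ht0 : (0 : ℝ) < t := by linarith [JBD.one_le_sub_one ht]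
  -- Both constants come from `abs_errBound_sub_le` at `ε = (τ / α) κ d / (g ω)`: `η` ensures `√t ε
  -- ≤ 1 / 8`, and `C` is the error `20 t ε²` rewritten in `κ d / (g ω)`.
  refine ⟨20 * t * (JBD.tau t / JBD.alpha t) ^ 2, by positivity,
    1 / (8 * (JBD.tau t / JBD.alpha t) * √(t : ℝ)), by positivity, ?_⟩
  intro s hs m A A' W W' γ hW hA hdim hW' hinj hγ hδ
  rw [lt_min_iff, EReal.coe_lt_coe_iff] at hδ
  refine ⟨fun N hN => ?_, fun d hd h => ?_⟩
  · obtain ⟨ν, hν, hν'⟩ := JBD.exists_mem_relDistSet_le_errBound ht hs hW hA hdim hW' hinj hγ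
      hδ.1 hδ.2 (JBD.isRightBounded_of_mem hN)
    obtain ⟨μ, hμ⟩ := JBD.exists_isLeast_relDistSet (JBD.continuous_of_mem hN) W W' ⟨ν, hν⟩
    exact ⟨μ, hμ, (hμ.2 hν).trans hν'⟩
  · exact JBD.abs_errBound_epsStar_sub_le ht (JBD.cond2_nonneg _) (JBD.gap_nonneg _)
      JBD.omegaUniq_nonneg hd h
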